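/- Let $m\ge 2$ and $n\ge 1$ be integers and let $\omega:[0,1]^m\to[0,\infty)$ be integrable. For $1<p<\infty$ and $\lambda\in\mathbb{R}$, the central Morrey space $\dot B^{p,\lambda}(\mathbb{R}^n)$ is the space of all $f\in L^p_{\mathrm{loc}}(\mathbb{R}^n)$ (complex-valued) with $$\|f\|_{\dot B^{p,\lambda}}:=\sup_{R>0}\Big(\frac1{|B(0,R)|^{1+\lambda p}}\int_{B(0,R)}|f(x)|^p\,dx\Big)^{1/p}<\infty,$$ and for $1<q<\infty$, $C\dot MO^q(\mathbb{R}^n)$ is the space of all $b\in L^q_{\mathrm{loc}}(\mathbb{R}^n)$ with $$\sup_{R>0}\Big(\frac1{|B(0,R)|}\int_{B(0,R)}|b(x)-b_{B(0,R)}|^q\,dx\Big)^{1/q}<\infty,\qquad b_{B(0,R)}:=\frac1{|B(0,R)|}\int_{B(0,R)}b(x)\,dx.$$ For $\vec b=(b_1,\dots,b_m)$ and $\vec f=(f_1,\dots,f_m)$, the commutator of the weighted multilinear Cesàro operator is $$\mathcal G_\omega^{\vec b}(\vec f)(x):=\int_{(0,1)^m}\Big(\prod_{i=1}^m f_i(x/t_i)\,t_i^{-n}\Big)\Big(\prod_{i=1}^m\big(b_i(x)-b_i(x/t_i)\big)\Big)\omega(\vec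 t)\,d\vec t .$$ It is called bounded from $\prod_{i=1}^m\dot B^{p_i,\lambda_i}(\mathbb{R}^n)$ to $\dot B^{p,\lambda}(\mathbb{R}^n)$ if for all $f_i\in\dot B^{p_i,\lambda_i}(\mathbb{R}^n)$ the integral converges absolutely for almost every $x$, and $\mathcal G_\omega^{\vec b}(\vec f)\in\dot B^{p,\lambda}(\mathbb{R}^n)$ with $\|\mathcal G_\omega^{\vec b}(\vec f)\|_{\dot B^{p,\lambda}}\le C\prod_{i=1}^m\|f_i\|_{\dot B^{p_i,\lambda_i}}$ for some finite constant $C$ independent of $\vec f$. **Theorem 4.2.** Let $1<p<p_i<\infty$, $1<q_i<\infty$ and $-1/p_i<\lambda_i<0$ for $i=1,\dots,m$, with $$\frac1p=\frac1{p_1}+\cdots+\frac1{p_m}+\frac1{q_1}+\cdots+\frac1{q_m},\qquad \lambda=\lambda_1+\cdots+\lambda_m,$$ and set $$\mathbb F_m:=\int_{(0,1)^m}\Big(\prod_{i=1}^m t_i^{-n\lambda_i-n}\Big)\,\omega(\vec t)\prod_{i=1}^m\log\frac2{t_i}\,d\vec t\in[0,\infty].$$ (i) If $\mathbb F_m<\infty$,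 then $\mathcal G_\omega^{\vec b}$ is bounded from $\prod_{i=1}^m\dot B^{p_i,\lambda_i}(\mathbb{R}^n)$ to $\dot B^{p,\lambda}(\mathbb{R}^n)$ for every $\vec b\in\prod_{i=1}^m C\dot MO^{q_i}(\mathbb{R}^n)$. (ii) Suppose $\lambda_1p_1=\cdots=\lambda_mp_m$. If $\mathcal G_\omega^{\vec b}$ is bounded from $\prod_{i=1}^m\dot B^{p_i,\lambda_i}(\mathbb{R}^n)$ to $\dot B^{p,\lambda}(\mathbb{R}^n)$ for every $\vec b\in\prod_{i=1}^m C\dot MO^{q_i}(\mathbb{R}^n)$, then $\mathbb F_m<\infty$. -/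

import Mathlib

open MeasureTheory
open scoped ENNReal NNReal

/-- `ℝⁿ` with the Euclidean norm and Lebesgue measure. -/
abbrev RSpace (n : ℕ) : Type := EuclideanSpace ℝ (Fin n)

/-- The open unit cube `{t : 0 < t₁, …, tₘ < 1}` in `ℝᵐ`. -/
def unitCube (m : ℕ) : Set (Fin m → ℝ) := Set.univ.pi fun _ => Set.Ioo (0 : ℝ) 1

/-- `f ∈ L^p_loc(ℝⁿ)`: `f` is (a.e. strongly) measurable and `p`-integrable on compact sets. -/
def MemLpLoc {n : ℕ} (p : ℝ) (f : RSpace n → ℂ) : Prop :=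
  AEStronglyMeasurable f volume ∧
    ∀ K : Set (RSpace n), IsCompact K → MemLp f (ENNReal.ofReal p) (volume.restrict K)

/-- The central Morrey norm
`sup_{R > 0} (|B(0,R)|^{-(1 + lam p)} ∫_{B(0,R)} |f|^p)^{1/p}`, with values in `[0, ∞]`. -/
noncomputable def morreyNorm {n : ℕ} (p lam : ℝ) (f : RSpace n → ℂ) : ℝ≥0∞ :=
  ⨆ (R : ℝ) (_ : 0 < R),
    ((∫⁻ x in Metric.ball (0 : RSpace n) R, ‖f x‖ₑ ^ p) /
      (volume (Metric.ball (0 : RSpace n) R)) ^ (1 + lam * p)) ^ (1 / p)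

/-- Membership in the central Morrey space `Ḃ^{p,lam}(ℝⁿ)`. -/
def MemMorrey {n : ℕ} (p lam : ℝ) (f : RSpace n → ℂ) : Prop :=
  MemLpLoc p f ∧ morreyNorm p lam f < ∞

/-- The central mean oscillation seminorm
`sup_{R > 0} (|B(0,R)|^{-1} ∫_{B(0,R)} |f - f_{B(0,R)}|^q)^{1/q}`, with values in `[0, ∞]`. -/
noncomputable def cmoNorm {n : ℕ} (q : ℝ) (f : RSpace n → ℂ) : ℝ≥0∞ :=
  ⨆ (R : ℝ) (_ : 0 < R),
    ((∫⁻ x in Metric.ball (0 : RSpace n) R,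
        ‖f x - ⨍ y in Metric.ball (0 : RSpace n) R, f y‖ₑ ^ q) /
      volume (Metric.ball (0 : RSpace n) R)) ^ (1 / q)

/-- Membership in the central bounded mean oscillation space of exponent `q` on `ℝⁿ`. -/
def MemCMO {n : ℕ} (q : ℝ) (f : RSpace n → ℂ) : Prop :=
  MemLpLoc q f ∧ cmoNorm q f < ∞

/-- The integrand, as a function of `t`, in the commutator of the weighted multilinear
Cesàro operator:
`(∏ᵢ fᵢ(x/tᵢ) tᵢ⁻ⁿ) (∏ᵢ (bᵢ(x) - bᵢ(x/tᵢ))) ω(t)`. -/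
noncomputable def cesaroIntegrand {m n : ℕ} (ω : (Fin m → ℝ) → ℝ)
    (b f : Fin m → RSpace n → ℂ) (x : RSpace n) (t : Fin m → ℝ) : ℂ :=
  (∏ i, f i ((t i)⁻¹ • x) * (((t i ^ n)⁻¹ : ℝ) : ℂ)) *
    (∏ i, (b i x - b i ((t i)⁻¹ • x))) * ((ω t : ℝ) : ℂ)

/-- The commutator of the weighted multilinear Cesàro operator with weight `ω` and
symbols `b₁, …, bₘ`, applied to `f₁, …, fₘ`. -/
noncomputable def cesaroCommutator {m n : ℕ} (ω : (Fin m → ℝ) → ℝ)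
    (b f : Fin m → RSpace n → ℂ) (x : RSpace n) : ℂ :=
  ∫ t in unitCube m, cesaroIntegrand ω b f x t

/-- The commutator with symbols `b` is a bounded operator from the product of the central Morrey
spaces `Ḃ^{P i, L i}` to `Ḃ^{p, lam}`: for all `f` in the product the defining (Lebesgue) integral
exists for almost every `x`, its value lies in `Ḃ^{p, lam}`, and the norm inequality holds with a
finite constant that does not depend on `f`. -/
def CesaroCommutatorBounded {m n : ℕ} (p lam : ℝ) (P L : Fin m → ℝ) (ω : (Fin m → ℝ) → ℝ)
    (b : Fin m → RSpace n → ℂ) : Prop :=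
  ∃ C : ℝ≥0, ∀ f : Fin m → RSpace n → ℂ, (∀ i, MemMorrey (P i) (L i) (f i)) →
    (∀ᵐ x : RSpace n, IntegrableOn (cesaroIntegrand ω b f x) (unitCube m)) ∧
    MemMorrey p lam (cesaroCommutator ω b f) ∧
    morreyNorm p lam (cesaroCommutator ω b f) ≤ C * ∏ i, morreyNorm (P i) (L i) (f i)

/-- The quantity
`∫_{0 < t₁, …, tₘ < 1} (∏ᵢ tᵢ^{-n Lᵢ - n}) ω(t) ∏ᵢ log (2 / tᵢ) dt`, with values in `[0, ∞]`. -/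
noncomputable def cesaroConst {m : ℕ} (n : ℕ) (L : Fin m → ℝ) (ω : (Fin m → ℝ) → ℝ) : ℝ≥0∞ :=
  ∫⁻ t in unitCube m, ENNReal.ofReal
    ((∏ i, t i ^ (-((n : ℝ) * L i) - (n : ℝ))) * ω t * ∏ i, Real.log (2 / t i))

/-! Sufficiency is scaling together with Hölder and Minkowski. For the normalized measure on
`B(0,R)`, replacing `f(x)` by `f(x/t)` replaces `B(0,R)` by `B(0,R/t)` and costs a factor `t^(-n
λᵢ)` in the Morrey bound. The difference `b(x) - b(x/t)` has `L^q` mean at most a constant times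
`log (2/t)` times the oscillation seminorm, since about `log₂ (1/t)` doublings link the averages
over the two balls (`eLpNorm_sub_dilation_le`). Hölder with all `2m` exponents bounds each slice in
`t`, and Minkowski in `t` sums the bounds to the constant of the theorem.

Necessity is proved by making the defining integral diverge. On the radial powers `|x|^(n λᵢ)` the
weight in that constant appears, but the symbol `log |x|` contributes only `log (1/tᵢ)`, which
degenerates as `tᵢ → 1`. So the symbols are `log |x| + i uᵢ(x)` with `uᵢ` bounded and so oscillating
that `|uᵢ(x) - uᵢ(x/tᵢ)|` makes up for the loss.

The `uᵢ` come from the probabilistic method. On a compact subcube of the open cube, `x` and `x/tᵢ`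
lie in different logarithmic shells; with independent random bits on the shells, the bits at the two
points differ with probability `1/2`, independently in `i`, so the expectation of `∏ (log (1/tᵢ) +
[bits differ])` is at least `2^(-m) ∏ log (2/tᵢ)`, and some choice of bits does as well
(`exists_bits_lintegral_bitKernel_ge`). If the constant is infinite, one such choice is made on each
of a sequence of subcubes, and the `k`-th bits become the `k`-th ternary digit of `uᵢ`. Distinct
`k`-th bits then force a gap of `3^(-k)/2`, a loss outweighed by taking the `k`-th subcube large.
Almost everywhere convergence of the integral would contradict dominated convergence on an annulus
(`exists_bounded_oscillation_diverges`). -/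

/-- The normalized Lebesgue measure on the ball `B(0, R)`. -/
noncomputable def ballMeasure (n : ℕ) (R : ℝ) : Measure (RSpace n) :=
  (volume (Metric.ball (0 : RSpace n) R))⁻¹ • volume.restrict (Metric.ball 0 R)

/-! ### Normalized ball measures: norms, dilation and doubling -/

section BallMeasure

variable {n : ℕ} {R : ℝ}

lemma volume_ball_ne_zero (hR : 0 < R) : volume (Metric.ball (0 : RSpace n) R) ≠ 0 :=
  (Metric.measure_ball_pos volume _ hR).ne'

lemma volume_ball_ne_top : volume (Metric.ball (0 : RSpace n) R) ≠ ∞ :=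
  measure_ball_lt_top.ne

lemma isProbabilityMeasure_ballMeasure (hR : 0 < R) :
    IsProbabilityMeasure (ballMeasure n R) := by
  constructor
  simp [ballMeasure, ENNReal.inv_mul_cancel (volume_ball_ne_zero hR) volume_ball_ne_top]

instance : SFinite (ballMeasure n R) := by
  unfold ballMeasure; infer_instance

lemma ballMeasure_absolutelyContinuous : ballMeasure n R ≪ volume :=
  Measure.smul_absolutelyContinuous.trans Measure.restrict_le_self.absolutelyContinuous

lemma average_ball (f : RSpace n → ℂ) :
    ⨍ y in Metric.ball (0 : RSpace n) R, f y = ∫ y, f y ∂ballMeasure n R := by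
  simp [average, ballMeasure]

lemma lintegral_ballMeasure (f : RSpace n → ℝ≥0∞) :
    ∫⁻ x, f x ∂ballMeasure n R =
      (∫⁻ x in Metric.ball (0 : RSpace n) R, f x) / volume (Metric.ball (0 : RSpace n) R) := by
  rw [ballMeasure, lintegral_smul_measure, smul_eq_mul, ENNReal.div_eq_inv_mul]

lemma eLpNorm_ofReal_exponent {α : Type*} [MeasurableSpace α] {μ : Measure α} {p : ℝ} (hp : 0 < p)
    (f : α → ℂ) : eLpNorm f (ENNReal.ofReal p) μ = (∫⁻ x, ‖f x‖ₑ ^ p ∂μ) ^ (1 / p) := by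
  rw [eLpNorm_eq_lintegral_rpow_enorm_toReal (by simpa using hp) ENNReal.ofReal_ne_top,
    ENNReal.toReal_ofReal hp.le]

lemma eLpNorm_ballMeasure {p : ℝ} (hp : 0 < p) (f : RSpace n → ℂ) :
    eLpNorm f (ENNReal.ofReal p) (ballMeasure n R) =
      ((∫⁻ x in Metric.ball (0 : RSpace n) R, ‖f x‖ₑ ^ p) /
        volume (Metric.ball (0 : RSpace n) R)) ^ (1 / p) := by
  rw [eLpNorm_ofReal_exponent hp, lintegral_ballMeasure]

/-- One factor of the volume normalizes the measure; the power `lam * p` comes out of the `p`-th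
root as `-lam`. -/
lemma morrey_term_eq {p : ℝ} (hp : 0 < p) (lam : ℝ) (f : RSpace n → ℂ) (hR : 0 < R) :
    ((∫⁻ x in Metric.ball (0 : RSpace n) R, ‖f x‖ₑ ^ p) /
      (volume (Metric.ball (0 : RSpace n) R)) ^ (1 + lam * p)) ^ (1 / p) =
    volume (Metric.ball (0 : RSpace n) R) ^ (-lam) *
      eLpNorm f (ENNReal.ofReal p) (ballMeasure n R) := by
  have h0 := volume_ball_ne_zero (n := n) hR
  have ht := volume_ball_ne_top (n := n) (R := R)
  rw [eLpNorm_ballMeasure hp, ENNReal.rpow_add _ _ h0 ht, ENNReal.rpow_one,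
    ENNReal.div_eq_inv_mul, ENNReal.div_eq_inv_mul, ENNReal.mul_inv (Or.inl h0) (Or.inl ht),
    mul_comm _⁻¹ (_ ^ (lam * p))⁻¹, mul_assoc,
    ENNReal.mul_rpow_of_nonneg _ _ (by positivity : 0 ≤ 1 / p), ← ENNReal.rpow_neg,
    ← ENNReal.rpow_mul]
  congr 2
  field_simp

lemma eLpNorm_le_morreyNorm {p : ℝ} (hp : 0 < p) (lam : ℝ) (f : RSpace n → ℂ) (hR : 0 < R) :
    eLpNorm f (ENNReal.ofReal p) (ballMeasure n R) ≤
      volume (Metric.ball (0 : RSpace n) R) ^ lam * morreyNorm p lam f := by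
  have h0 := volume_ball_ne_zero (n := n) hR
  have ht := volume_ball_ne_top (n := n) (R := R)
  have h : volume (Metric.ball (0 : RSpace n) R) ^ (-lam) *
      eLpNorm f (ENNReal.ofReal p) (ballMeasure n R) ≤ morreyNorm p lam f := by
    rw [← morrey_term_eq hp lam f hR]
    exact le_iSup₂ (f := fun (R : ℝ) (_ : 0 < R) =>
      ((∫⁻ x in Metric.ball (0 : RSpace n) R, ‖f x‖ₑ ^ p) /
      (volume (Metric.ball (0 : RSpace n) R)) ^ (1 + lam * p)) ^ (1 / p)) R hR
  calc _ = volume (Metric.ball (0 : RSpace n) R) ^ lam *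
        (volume (Metric.ball (0 : RSpace n) R) ^ (-lam) *
      eLpNorm f (ENNReal.ofReal p) (ballMeasure n R)) := by
        rw [← mul_assoc, ← ENNReal.rpow_add _ _ h0 ht]; simp
    _ ≤ _ := by gcongr

lemma morreyNorm_le {p : ℝ} (hp : 0 < p) (lam : ℝ) (f : RSpace n → ℂ) {A : ℝ≥0∞}
    (h : ∀ R : ℝ, 0 < R → eLpNorm f (ENNReal.ofReal p) (ballMeasure n R) ≤
      volume (Metric.ball (0 : RSpace n) R) ^ lam * A) : morreyNorm p lam f ≤ A := by
  refine iSup₂_le fun R hR => ?_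
  have h0 := volume_ball_ne_zero (n := n) hR
  have ht := volume_ball_ne_top (n := n) (R := R)
  rw [morrey_term_eq hp lam f hR]
  calc _ ≤ volume (Metric.ball (0 : RSpace n) R) ^ (-lam) *
        (volume (Metric.ball (0 : RSpace n) R) ^ lam * A) := by gcongr; exact h R hR
    _ = A := by rw [← mul_assoc, ← ENNReal.rpow_add _ _ h0 ht]; simp

lemma eLpNorm_sub_average_le_cmoNorm {q : ℝ} (hq : 0 < q) (f : RSpace n → ℂ) (hR : 0 < R) :
    eLpNorm (fun x => f x - ∫ y, f y ∂ballMeasure n R) (ENNReal.ofReal q) (ballMeasure n R) ≤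
      cmoNorm q f := by
  rw [eLpNorm_ballMeasure hq, ← average_ball]
  exact le_iSup₂ (f := fun (R : ℝ) (_ : 0 < R) =>
    ((∫⁻ x in Metric.ball (0 : RSpace n) R,
        ‖f x - ⨍ y in Metric.ball (0 : RSpace n) R, f y‖ₑ ^ q) /
      volume (Metric.ball (0 : RSpace n) R)) ^ (1 / q)) R hR

lemma cmoNorm_le {q : ℝ} (hq : 0 < q) (f : RSpace n → ℂ) {A : ℝ≥0∞}
    (h : ∀ R : ℝ, 0 < R → eLpNorm (fun x => f x - ∫ y, f y ∂ballMeasure n R) (ENNReal.ofReal q)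
      (ballMeasure n R) ≤ A) : cmoNorm q f ≤ A := by
  refine iSup₂_le fun R hR => ?_
  have := h R hR
  rwa [eLpNorm_ballMeasure hq, ← average_ball] at this

lemma volume_ball_mul {c : ℝ} (hc : 0 < c) (R : ℝ) :
    volume (Metric.ball (0 : RSpace n) (c * R)) =
      ENNReal.ofReal c ^ n * volume (Metric.ball (0 : RSpace n) R) := by
  rw [Measure.addHaar_ball_mul_of_pos _ _ hc, ENNReal.ofReal_pow hc.le,
    Measure.addHaar_ball_center]
  simp

lemma map_smul_ballMeasure {c : ℝ} (hc : 0 < c) (hR : 0 < R) :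
    (ballMeasure n R).map (c • ·) = ballMeasure n (c * R) := by
  have h0 := volume_ball_ne_zero (n := n) hR
  have ht := volume_ball_ne_top (n := n) (R := R)
  have hpre : (fun x : RSpace n => c • x) ⁻¹' Metric.ball 0 (c * R) = Metric.ball 0 R := by
    ext x
    simp [norm_smul, abs_of_pos hc, hc]
  have hc0 : ENNReal.ofReal c ≠ 0 := by simpa using hc
  rw [ballMeasure, ballMeasure, Measure.map_smul, volume_ball_mul hc, ← hpre,
    ← Measure.restrict_map (measurable_const_smul c) measurableSet_ball,
    Measure.map_addHaar_smul _ hc.ne', Measure.restrict_smul, smul_smul, hpre]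
  congr 1
  rw [ENNReal.mul_inv (Or.inr ht) (Or.inr h0), abs_of_pos (by positivity),
    ENNReal.ofReal_inv_of_pos (by positivity), mul_comm, ENNReal.ofReal_pow hc.le]
  simp

lemma eLpNorm_comp_smul {c : ℝ} (hc : 0 < c) (hR : 0 < R) (p : ℝ≥0∞) (f : RSpace n → ℂ) :
    eLpNorm (fun x => f (c • x)) p (ballMeasure n R) = eLpNorm f p (ballMeasure n (c * R)) := by
  rw [← map_smul_ballMeasure hc hR]
  exact ((Homeomorph.smulOfNeZero c hc.ne').measurableEmbedding.eLpNorm_map_measure).symm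

lemma ballMeasure_le_smul {R' : ℝ} (hR : 0 < R) (h : R ≤ R') (h' : R' ≤ 2 * R) :
    ballMeasure n R ≤ (2 ^ n : ℝ≥0∞) • ballMeasure n R' := by
  have hR' : 0 < R' := hR.trans_le h
  have h1 : volume (Metric.ball (0 : RSpace n) R') ≤
      2 ^ n * volume (Metric.ball (0 : RSpace n) R) := by
    have := volume_ball_mul (n := n) two_pos R
    rw [show ENNReal.ofReal 2 = 2 by simp] at this
    rw [← this]
    exact measure_mono (Metric.ball_subset_ball h')
  have h2 : (volume (Metric.ball (0 : RSpace n) R))⁻¹ ≤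
      2 ^ n * (volume (Metric.ball (0 : RSpace n) R'))⁻¹ := by
    rw [← div_eq_mul_inv,
      ENNReal.le_div_iff_mul_le (Or.inl (volume_ball_ne_zero hR')) (Or.inl volume_ball_ne_top),
      mul_comm, ← div_eq_mul_inv]
    exact ENNReal.div_le_of_le_mul h1
  rw [ballMeasure, ballMeasure, smul_smul]
  intro s
  simp only [Measure.smul_apply, smul_eq_mul]
  gcongr ?_ * ?_
  exact Measure.restrict_mono (Metric.ball_subset_ball h) le_rfl s

lemma memLpLoc_of_eLpNorm_lt_top {p : ℝ} {f : RSpace n → ℂ} (hf : AEStronglyMeasurable f volume)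
    (h : ∀ R : ℝ, 0 < R → eLpNorm f (ENNReal.ofReal p) (ballMeasure n R) < ∞) : MemLpLoc p f := by
  refine ⟨hf, fun K hK => ⟨hf.restrict, ?_⟩⟩
  obtain ⟨R, hR, hKR⟩ := hK.isBounded.subset_ball_lt 0 0
  refine (eLpNorm_mono_measure f (Measure.restrict_mono hKR le_rfl)).trans_lt ?_
  have hV : volume.restrict (Metric.ball (0 : RSpace n) R) =
      volume (Metric.ball (0 : RSpace n) R) • ballMeasure n R := by
    rw [ballMeasure, smul_smul, ENNReal.mul_inv_cancel (volume_ball_ne_zero hR) volume_ball_ne_top,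
      one_smul]
  rw [hV]
  refine (eLpNorm_smul_measure_le _ _ _ _).trans_lt ?_
  rw [smul_eq_mul]
  exact ENNReal.mul_lt_top (ENNReal.rpow_lt_top_of_nonneg ENNReal.toReal_nonneg volume_ball_ne_top)
    (h R hR)

lemma MemLpLoc.memLp_ballMeasure {p : ℝ} {f : RSpace n → ℂ} (hf : MemLpLoc p f) (hR : 0 < R) :
    MemLp f (ENNReal.ofReal p) (ballMeasure n R) := by
  have h := hf.2 _ (isCompact_closedBall (0 : RSpace n) R)
  exact (h.mono_measure (Measure.restrict_mono Metric.ball_subset_closedBall le_rfl)).smul_measure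
    (ENNReal.inv_ne_top.2 (volume_ball_ne_zero hR))

end BallMeasure

/-! ### Central mean oscillation under dilation -/

section MeanOscillation

variable {n : ℕ} {R : ℝ}

lemma one_le_ofReal_of_one_lt {q : ℝ} (hq : 1 < q) : 1 ≤ ENNReal.ofReal q := by
  simpa using hq.le

lemma enorm_integral_sub_le_lintegral {α : Type*} [MeasurableSpace α] {μ : Measure α}
    [IsProbabilityMeasure μ] {q : ℝ} (hq : 1 < q) {f : α → ℂ} (hf : MemLp f (ENNReal.ofReal q) μ)
    (c : ℂ) : ‖∫ x, f x ∂μ - c‖ₑ ≤ ∫⁻ x, ‖f x - c‖ₑ ∂μ := by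
  have hi : Integrable f μ := hf.integrable (one_le_ofReal_of_one_lt hq)
  have : ∫ x, f x ∂μ - c = ∫ x, (f x - c) ∂μ := by
    rw [integral_sub hi (integrable_const c)]; simp
  rw [this]
  exact enorm_integral_le_lintegral_enorm _

lemma lintegral_enorm_le_eLpNorm {α : Type*} [MeasurableSpace α] {μ : Measure α}
    [IsProbabilityMeasure μ] {q : ℝ} (hq : 1 < q) {f : α → ℂ} (hf : AEStronglyMeasurable f μ) :
    ∫⁻ x, ‖f x‖ₑ ∂μ ≤ eLpNorm f (ENNReal.ofReal q) μ := by
  rw [← eLpNorm_one_eq_lintegral_enorm]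
  exact eLpNorm_le_eLpNorm_of_exponent_le (one_le_ofReal_of_one_lt hq) hf

lemma enorm_average_sub_average_le {q : ℝ} (hq : 1 < q) {b : RSpace n → ℂ} (hb : MemLpLoc q b)
    (hR : 0 < R) {R' : ℝ} (h : R ≤ R') (h' : R' ≤ 2 * R) :
    ‖∫ x, b x ∂ballMeasure n R - ∫ x, b x ∂ballMeasure n R'‖ₑ ≤ 2 ^ n * cmoNorm q b := by
  have hR' : 0 < R' := hR.trans_le h
  have := isProbabilityMeasure_ballMeasure (n := n) hR
  have := isProbabilityMeasure_ballMeasure (n := n) hR'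
  refine (enorm_integral_sub_le_lintegral hq (hb.memLp_ballMeasure hR) _).trans ?_
  refine (lintegral_mono' (ballMeasure_le_smul hR h h') le_rfl).trans ?_
  rw [lintegral_smul_measure, smul_eq_mul]
  gcongr
  refine (lintegral_enorm_le_eLpNorm hq ?_).trans
    (eLpNorm_sub_average_le_cmoNorm (zero_lt_one.trans hq) b hR')
  exact (hb.memLp_ballMeasure hR').1.sub aestronglyMeasurable_const

/-- Telescoping over a chain of radii in which each is at most twice the previous one. -/
lemma enorm_average_sub_average_le_nsmul {q : ℝ} (hq : 1 < q) {b : RSpace n → ℂ}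
    (hb : MemLpLoc q b) (hR : 0 < R) (k : ℕ) {R' : ℝ} (h : R ≤ R') (h' : R' ≤ 2 ^ k * R) :
    ‖∫ x, b x ∂ballMeasure n R - ∫ x, b x ∂ballMeasure n R'‖ₑ ≤ k * (2 ^ n * cmoNorm q b) := by
  induction k generalizing R' with
  | zero =>
    have : R' = R := le_antisymm (by simpa using h') h
    simp [this]
  | succ k ih =>
    -- Halving `R'` could drop below `R`; the maximum keeps the intermediate radius admissible for
    -- both the induction hypothesis and the single doubling step.
    have hm : R ≤ max R (R' / 2) := le_max_left _ _
    have h1 := ih hm (max_le (by nlinarith [one_le_pow₀ (M₀ := ℝ) one_le_two (n := k)])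
      (by rw [pow_succ] at h'; linarith))
    have h2 := enorm_average_sub_average_le hq hb (hR.trans_le hm)
      (max_le h (by linarith) : max R (R' / 2) ≤ R') (by linarith [le_max_right R (R' / 2)])
    calc _ ≤ _ + _ := by
          rw [← sub_add_sub_cancel _ (∫ x, b x ∂ballMeasure n (max R (R' / 2)))]
          exact enorm_add_le _ _
      _ ≤ _ := add_le_add h1 h2
      _ = _ := by push_cast; ring

/-- The constant in the mean oscillation estimate for dilation differences. -/
noncomputable def dilationConst (n : ℕ) : ℝ := (2 + 2 ^ n) / Real.log 2

/-- Compare `b(x)` with its average on `B(0,R)`, `b(x/t)` with the average on `B(0,R/t)`, and the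
two averages with each other. The first two cost one seminorm each, the last one `2^n` seminorms per
doubling. -/
lemma eLpNorm_sub_dilation_le {q : ℝ} (hq : 1 < q) {b : RSpace n → ℂ} (hb : MemLpLoc q b)
    (hR : 0 < R) {t : ℝ} (ht : 0 < t) (ht' : t < 1) :
    eLpNorm (fun x => b x - b (t⁻¹ • x)) (ENNReal.ofReal q) (ballMeasure n R) ≤
      ENNReal.ofReal (dilationConst n * Real.log (2 / t)) * cmoNorm q b := by
  have hq0 : 0 < q := zero_lt_one.trans hq
  have hti : 0 < t⁻¹ := inv_pos.2 ht
  have hR' : 0 < t⁻¹ * R := mul_pos hti hR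
  have hlog2 : 0 < Real.log 2 := Real.log_pos one_lt_two
  have hprob := isProbabilityMeasure_ballMeasure (n := n) hR
  set a := ∫ x, b x ∂ballMeasure n R
  set a' := ∫ x, b x ∂ballMeasure n (t⁻¹ * R)
  have hlog : Real.log (2 / t) = Real.log 2 + Real.log t⁻¹ := by
    rw [div_eq_mul_inv, Real.log_mul two_ne_zero hti.ne']
  have hlogt : 0 ≤ Real.log t⁻¹ := Real.log_nonneg ((one_le_inv₀ ht).2 ht'.le)
  -- The number of doublings from `R` to `R/t`. Rounding up costs at most `1`, which the `2` in `log
  -- (2/t)` absorbs.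
  set k := ⌈Real.log t⁻¹ / Real.log 2⌉₊
  have hk1 : t⁻¹ ≤ 2 ^ k := by
    rw [← Real.log_le_log_iff hti (by positivity), Real.log_pow, ← div_le_iff₀ hlog2]
    exact Nat.le_ceil _
  have hk2 : (k : ℝ) ≤ Real.log (2 / t) / Real.log 2 := by
    rw [hlog, add_div, div_self hlog2.ne', add_comm]
    exact (Nat.ceil_lt_add_one (div_nonneg hlogt hlog2.le)).le
  have h1 : ‖a - a'‖ₑ ≤ k * (2 ^ n * cmoNorm q b) :=
    enorm_average_sub_average_le_nsmul hq hb hR k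
      (le_mul_of_one_le_left hR.le ((one_le_inv₀ ht).2 ht'.le)) (by gcongr)
  have h2 := eLpNorm_sub_average_le_cmoNorm hq0 b hR
  have h3 := eLpNorm_sub_average_le_cmoNorm hq0 b hR'
  rw [← eLpNorm_comp_smul hti hR _ (fun x => b x - a')] at h3
  have hm1 : AEStronglyMeasurable (fun x => b x - a) (ballMeasure n R) :=
    (hb.memLp_ballMeasure hR).1.sub aestronglyMeasurable_const
  have hm2 : AEStronglyMeasurable (fun x => b (t⁻¹ • x) - a') (ballMeasure n R) := by
    refine AEStronglyMeasurable.sub ?_ aestronglyMeasurable_const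
    have := (hb.memLp_ballMeasure hR').1
    rw [← map_smul_ballMeasure hti hR] at this
    exact this.comp_measurable (measurable_const_smul t⁻¹)
  have h1q := one_le_ofReal_of_one_lt hq
  have hsplit : (fun x => b x - b (t⁻¹ • x)) =
      ((fun x => b x - a) - fun x => b (t⁻¹ • x) - a') + fun _ => a - a' := by
    ext x
    simp only [Pi.add_apply, Pi.sub_apply]
    ring
  rw [hsplit]
  calc _ ≤ eLpNorm (fun x => b x - a) (ENNReal.ofReal q) (ballMeasure n R) +
        eLpNorm (fun x => b (t⁻¹ • x) - a') (ENNReal.ofReal q) (ballMeasure n R) +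
        eLpNorm (fun _ => a - a') (ENNReal.ofReal q) (ballMeasure n R) :=
        (eLpNorm_add_le (hm1.sub hm2) aestronglyMeasurable_const h1q).trans
          (add_le_add_left (eLpNorm_sub_le hm1 hm2 h1q) _)
    _ ≤ cmoNorm q b + cmoNorm q b + k * (2 ^ n * cmoNorm q b) := by
        refine add_le_add (add_le_add h2 h3) ?_
        rw [eLpNorm_const _ (by simpa using hq0) (NeZero.ne _)]
        simpa using h1
    _ = ENNReal.ofReal (2 + k * 2 ^ n) * cmoNorm q b := by
        rw [ENNReal.ofReal_add (by positivity) (by positivity),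
          ENNReal.ofReal_mul (by positivity), ENNReal.ofReal_pow (by positivity)]
        simp
        ring
    _ ≤ _ := by
        gcongr
        have h4 : 1 ≤ Real.log (2 / t) / Real.log 2 := by
          rw [le_div_iff₀ hlog2]; linarith
        have : dilationConst n * Real.log (2 / t) =
            2 * (Real.log (2 / t) / Real.log 2) + Real.log (2 / t) / Real.log 2 * 2 ^ n := by
          rw [dilationConst]; ring
        rw [this]
        gcongr
        linarith

/-- The average may be replaced by any constant `c` depending on the ball: the average is within `A`
of `c`, so the seminorm is at most `2A`. -/
lemma memCMO_of_eLpNorm_sub_le {q : ℝ} (hq : 1 < q) {b : RSpace n → ℂ}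
    (hb : AEStronglyMeasurable b volume) {A : ℝ≥0∞} (hA : A < ∞)
    (h : ∀ R : ℝ, 0 < R → ∃ c : ℂ,
      eLpNorm (fun x => b x - c) (ENNReal.ofReal q) (ballMeasure n R) ≤ A) : MemCMO q b := by
  have hq0 : 0 < q := zero_lt_one.trans hq
  have hmeas (c : ℂ) (R : ℝ) : AEStronglyMeasurable (fun x => b x - c) (ballMeasure n R) :=
    (hb.mono_ac ballMeasure_absolutelyContinuous).sub aestronglyMeasurable_const
  have hloc : MemLpLoc q b := by
    refine memLpLoc_of_eLpNorm_lt_top hb fun R hR => ?_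
    obtain ⟨c, hc⟩ := h R hR
    have := isProbabilityMeasure_ballMeasure (n := n) hR
    have hb' : b = (fun x => b x - c) + fun _ => c := by ext; simp
    rw [hb']
    exact (MemLp.add ⟨hmeas c R, hc.trans_lt hA⟩ (memLp_const c)).2
  refine ⟨hloc, (cmoNorm_le (A := A + A) hq0 b fun R hR => ?_).trans_lt (by simpa using hA)⟩
  obtain ⟨c, hc⟩ := h R hR
  have hprob := isProbabilityMeasure_ballMeasure (n := n) hR
  have hsplit : (fun x => b x - ∫ y, b y ∂ballMeasure n R) =
      (fun x => b x - c) - fun _ => ∫ y, b y ∂ballMeasure n R - c := by ext; simp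
  rw [hsplit]
  refine (eLpNorm_sub_le (hmeas c R) aestronglyMeasurable_const
    (one_le_ofReal_of_one_lt hq)).trans (add_le_add hc ?_)
  rw [eLpNorm_const _ (by simpa using hq0) (NeZero.ne _)]
  simp only [measure_univ, ENNReal.one_rpow, mul_one]
  exact (enorm_integral_sub_le_lintegral hq (hloc.memLp_ballMeasure hR) c).trans
    ((lintegral_enorm_le_eLpNorm hq (hmeas c R)).trans hc)

end MeanOscillation

/-! ### Hölder for finite products and Minkowski's inequality -/

section IntegralInequalities

/-- Hölder applied to `g i ^ r i` with weights `p / r i`, which sum to `1`. -/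
lemma lintegral_prod_rpow_le {α ι : Type*} [MeasurableSpace α] [Fintype ι] {μ : Measure α}
    {g : ι → α → ℝ≥0∞} (hg : ∀ i, AEMeasurable (g i) μ) {p : ℝ} (hp : 0 < p) {r : ι → ℝ}
    (hr : ∀ i, 0 < r i) (hpr : 1 / p = ∑ i, 1 / r i) :
    ∫⁻ x, (∏ i, g i x) ^ p ∂μ ≤ (∏ i, (∫⁻ x, g i x ^ r i ∂μ) ^ (1 / r i)) ^ p := by
  have h := ENNReal.lintegral_prod_norm_pow_le (μ := μ) Finset.univ
    (f := fun i x => g i x ^ r i) (fun i _ => (hg i).pow_const _) (p := fun i => p * (1 / r i))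
    (by rw [← Finset.mul_sum, ← hpr]; field_simp) (fun i _ => by have := hr i; positivity)
  have h1 (i : ι) : r i * (p * (1 / r i)) = p := by have := (hr i).ne'; field_simp
  simp only [← ENNReal.rpow_mul, h1, ENNReal.prod_rpow_of_nonneg hp.le] at h
  refine h.trans_eq ?_
  rw [← ENNReal.prod_rpow_of_nonneg hp.le]
  simp only [← ENNReal.rpow_mul, mul_comm]

/-- Minkowski's integral inequality for a kernel whose sections are uniformly bounded in `L^p`. -/
lemma lintegral_lintegral_rpow_le {α β : Type*} [MeasurableSpace α] [MeasurableSpace β]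
    {ν : Measure α} {μ : Measure β} [SFinite ν] [SFinite μ] {g : α → β → ℝ≥0∞}
    (hg : AEMeasurable (Function.uncurry g) (ν.prod μ)) {p : ℝ} (hp : 1 < p) {A : ℝ≥0∞}
    (hA : ∀ᵐ t ∂ν, ∫⁻ x, g t x ^ p ∂μ ≤ A ^ p) :
    ∫⁻ x, (∫⁻ t, g t x ∂ν) ^ p ∂μ ≤ (A * ν Set.univ) ^ p := by
  have hp0 : 0 < p := zero_lt_one.trans hp
  have hpq := Real.HolderConjugate.conjExponent hp
  have hsec : ∀ᵐ x ∂μ, AEMeasurable (fun t => g t x) ν :=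
    hg.prod_swap.aestronglyMeasurable.prodMk_left.mono fun _ h => h.aemeasurable
  -- Because the bound on the sections is uniform in `t`, Hölder against the constant `1` followed
  -- by Tonelli suffices.
  have hjensen : ∀ᵐ x ∂μ, (∫⁻ t, g t x ∂ν) ^ p ≤
      (∫⁻ t, g t x ^ p ∂ν) * ν Set.univ ^ (p - 1) := by
    filter_upwards [hsec] with x hx
    have h := ENNReal.lintegral_mul_le_Lp_mul_Lq ν hpq hx
      (aemeasurable_const (b := (1 : ℝ≥0∞)))
    simp only [Pi.mul_apply, mul_one, ENNReal.one_rpow, lintegral_one] at h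
    calc _ ≤ ((∫⁻ t, g t x ^ p ∂ν) ^ (1 / p) * ν Set.univ ^ (1 / p.conjExponent)) ^ p := by
          gcongr
      _ = _ := by
          rw [ENNReal.mul_rpow_of_nonneg _ _ hp0.le, ← ENNReal.rpow_mul, ← ENNReal.rpow_mul]
          congr 2
          · rw [one_div_mul_cancel hp0.ne', ENNReal.rpow_one]
          · rw [Real.conjExponent]; field_simp
  have hgp : AEMeasurable (Function.uncurry fun t x => g t x ^ p) (ν.prod μ) := hg.pow_const p
  calc _ ≤ ∫⁻ x, (∫⁻ t, g t x ^ p ∂ν) * ν Set.univ ^ (p - 1) ∂μ := lintegral_mono_ae hjensen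
    _ = (∫⁻ x, ∫⁻ t, g t x ^ p ∂ν ∂μ) * ν Set.univ ^ (p - 1) :=
        lintegral_mul_const'' _ hgp.prod_swap.lintegral_prod_right'
    _ = (∫⁻ t, ∫⁻ x, g t x ^ p ∂μ ∂ν) * ν Set.univ ^ (p - 1) := by
        rw [lintegral_lintegral_swap hgp]
    _ ≤ (∫⁻ _, A ^ p ∂ν) * ν Set.univ ^ (p - 1) := by
        gcongr ?_ * _
        exact lintegral_mono_ae hA
    _ = _ := by
        rw [lintegral_const, ENNReal.mul_rpow_of_nonneg _ _ hp0.le, mul_assoc]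
        congr 1
        nth_rewrite 1 [← ENNReal.rpow_one (ν Set.univ)]
        rw [← ENNReal.rpow_add_of_nonneg _ _ zero_le_one (by linarith)]
        congr 1
        ring

end IntegralInequalities

/-! ### Joint measurability of the integrand -/

section Measurability

variable {m n : ℕ}

lemma measurableSet_unitCube : MeasurableSet (unitCube m) :=
  MeasurableSet.univ_pi fun _ => measurableSet_Ioo

lemma unitCube_subset_Icc : unitCube m ⊆ Set.Icc 0 1 := fun _ ht =>
  ⟨fun i => (ht i trivial).1.le, fun i => (ht i trivial).2.le⟩

/-- Functions defined only up to null sets can be composed with the dilation because, for each `t`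
in the cube, it pulls null sets back to null sets. -/
lemma quasiMeasurePreserving_dilation (i : Fin m) :
    Measure.QuasiMeasurePreserving (fun z : (Fin m → ℝ) × RSpace n => (z.1 i)⁻¹ • z.2)
      ((volume.restrict (unitCube m)).prod volume) volume := by
  have hmeas : Measurable fun z : (Fin m → ℝ) × RSpace n => (z.1 i)⁻¹ • z.2 := by fun_prop
  refine ⟨hmeas, Measure.AbsolutelyContinuous.mk fun s hs h0 => ?_⟩
  rw [Measure.map_apply hmeas hs, Measure.measure_prod_null (hmeas hs)]
  filter_upwards [ae_restrict_mem measurableSet_unitCube] with t ht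
  exact (Measure.quasiMeasurePreserving_smul volume
    (inv_ne_zero (ht i trivial).1.ne')).preimage_null h0

lemma aestronglyMeasurable_comp_dilation {f : RSpace n → ℂ} (hf : AEStronglyMeasurable f volume)
    (i : Fin m) : AEStronglyMeasurable (fun z : (Fin m → ℝ) × RSpace n => f ((z.1 i)⁻¹ • z.2))
      ((volume.restrict (unitCube m)).prod volume) :=
  hf.comp_quasiMeasurePreserving (quasiMeasurePreserving_dilation i)

lemma aestronglyMeasurable_cesaroIntegrand {ω : (Fin m → ℝ) → ℝ}
    (hω : AEStronglyMeasurable ω (volume.restrict (unitCube m))) {b f : Fin m → RSpace n → ℂ}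
    (hb : ∀ i, AEStronglyMeasurable (b i) volume) (hf : ∀ i, AEStronglyMeasurable (f i) volume) :
    AEStronglyMeasurable (fun z : (Fin m → ℝ) × RSpace n => cesaroIntegrand ω b f z.2 z.1)
      ((volume.restrict (unitCube m)).prod volume) := by
  unfold cesaroIntegrand
  refine AEStronglyMeasurable.mul (AEStronglyMeasurable.mul ?_ ?_) ?_
  · refine Finset.aestronglyMeasurable_fun_prod _ fun i _ => ?_
    refine (aestronglyMeasurable_comp_dilation (hf i) i).mul ?_
    exact Measurable.aestronglyMeasurable (by fun_prop)
  · refine Finset.aestronglyMeasurable_fun_prod _ fun i _ => ?_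
    exact (hb i).comp_snd.sub (aestronglyMeasurable_comp_dilation (hb i) i)
  · exact Complex.continuous_ofReal.comp_aestronglyMeasurable hω.comp_fst

end Measurability

/-! ### Sufficiency of the integral condition -/

section Sufficiency

variable {m n : ℕ}

/-- The density of `cesaroConst`. -/
noncomputable def cesaroDensity (n : ℕ) (L : Fin m → ℝ) (ω : (Fin m → ℝ) → ℝ) (t : Fin m → ℝ) :
    ℝ≥0∞ :=
  ENNReal.ofReal
    ((∏ i, t i ^ (-((n : ℝ) * L i) - (n : ℝ))) * ω t * ∏ i, Real.log (2 / t i))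

/-- The norm growth factor of dilation by `tᵢ` in both the function and the symbol. -/
noncomputable def dilationFactor (n : ℕ) (L : Fin m → ℝ) (t : Fin m → ℝ) : ℝ :=
  ∏ i, (t i ^ (-((n : ℝ) * L i)) * Real.log (2 / t i))

lemma log_two_div_pos {t : ℝ} (ht : t ∈ Set.Ioo (0 : ℝ) 1) : 0 < Real.log (2 / t) :=
  Real.log_pos (by rw [lt_div_iff₀ ht.1]; linarith [ht.2])

lemma dilationFactor_pos (L : Fin m → ℝ) {t : Fin m → ℝ} (ht : t ∈ unitCube m) :
    0 < dilationFactor n L t :=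
  Finset.prod_pos fun i _ =>
    mul_pos (Real.rpow_pos_of_pos (ht i trivial).1 _) (log_two_div_pos (ht i trivial))

lemma volume_ball_inv_mul_rpow {t : ℝ} (ht : 0 < t) (R a : ℝ) :
    volume (Metric.ball (0 : RSpace n) (t⁻¹ * R)) ^ a =
      ENNReal.ofReal (t ^ (-((n : ℝ) * a))) * volume (Metric.ball (0 : RSpace n) R) ^ a := by
  rw [volume_ball_mul (inv_pos.2 ht), ENNReal.mul_rpow_of_ne_top (by simp) volume_ball_ne_top,
    ← ENNReal.ofReal_pow (by positivity), ENNReal.ofReal_rpow_of_pos (by positivity)]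
  congr 2
  rw [← Real.rpow_natCast, ← Real.rpow_mul (by positivity), Real.inv_rpow ht.le,
    Real.rpow_neg ht.le]

/-- Hölder at a fixed `t`, with the `m` functions and the `m` symbol differences as factors; all
dependence on `t` collects in `dilationFactor`. -/
lemma lintegral_dilated_prod_rpow_le {p : ℝ} {P q L : Fin m → ℝ} (hp : 1 < p)
    (hP : ∀ i, p < P i) (hq : ∀ i, 1 < q i) (hpq : 1 / p = ∑ i, 1 / P i + ∑ i, 1 / q i)
    {b f : Fin m → RSpace n → ℂ} (hb : ∀ i, MemLpLoc (q i) (b i))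
    (hf : ∀ i, MemLpLoc (P i) (f i)) {R : ℝ} (hR : 0 < R) {t : Fin m → ℝ} (ht : t ∈ unitCube m) :
    ∫⁻ x, ((∏ i, ‖f i ((t i)⁻¹ • x)‖ₑ) * ∏ i, ‖b i x - b i ((t i)⁻¹ • x)‖ₑ) ^ p
        ∂ballMeasure n R ≤
      (ENNReal.ofReal (dilationFactor n L t) *
        (volume (Metric.ball (0 : RSpace n) R) ^ (∑ i, L i) *
          ∏ i, (morreyNorm (P i) (L i) (f i) *
            (ENNReal.ofReal (dilationConst n) * cmoNorm (q i) (b i))))) ^ p := by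
  have hp0 : 0 < p := zero_lt_one.trans hp
  have hcomp {g : RSpace n → ℂ} (hg : AEStronglyMeasurable g volume) (i : Fin m) :
      AEStronglyMeasurable (fun x => g ((t i)⁻¹ • x)) (ballMeasure n R) :=
    (hg.comp_quasiMeasurePreserving (Measure.quasiMeasurePreserving_smul volume
      (inv_ne_zero (ht i trivial).1.ne'))).mono_ac ballMeasure_absolutelyContinuous
  have h := lintegral_prod_rpow_le (μ := ballMeasure n R) (ι := Fin m ⊕ Fin m)
    (g := Sum.elim (fun i x => ‖f i ((t i)⁻¹ • x)‖ₑ)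
      fun i x => ‖b i x - b i ((t i)⁻¹ • x)‖ₑ) (r := Sum.elim P q) (p := p)
    (by
      rintro (i | i)
      · exact (hcomp (hf i).1 i).enorm
      · exact (((hb i).1.mono_ac ballMeasure_absolutelyContinuous).sub (hcomp (hb i).1 i)).enorm)
    hp0
    (by
      rintro (i | i)
      · exact hp0.trans (hP i)
      · exact zero_lt_one.trans (hq i))
    (by simpa [Fintype.sum_sum_type] using hpq)
  simp only [Fintype.prod_sum_type, Sum.elim_inl, Sum.elim_inr] at h
  refine h.trans ?_
  gcongr ?_ ^ p
  have hV0 := volume_ball_ne_zero (n := n) hR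
  have hVt := volume_ball_ne_top (n := n) (R := R)
  calc _ ≤ (∏ i, (ENNReal.ofReal (t i ^ (-((n : ℝ) * L i))) *
          volume (Metric.ball (0 : RSpace n) R) ^ L i * morreyNorm (P i) (L i) (f i))) *
        ∏ i, (ENNReal.ofReal (dilationConst n * Real.log (2 / t i)) * cmoNorm (q i) (b i)) := by
        gcongr with i _ i _
        · have hPi : 0 < P i := hp0.trans (hP i)
          rw [← eLpNorm_ofReal_exponent hPi fun x => f i ((t i)⁻¹ • x),
            eLpNorm_comp_smul (inv_pos.2 (ht i trivial).1) hR,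
            ← volume_ball_inv_mul_rpow (ht i trivial).1]
          exact eLpNorm_le_morreyNorm hPi _ _ (mul_pos (inv_pos.2 (ht i trivial).1) hR)
        · rw [← eLpNorm_ofReal_exponent (zero_lt_one.trans (hq i))
            fun x => b i x - b i ((t i)⁻¹ • x)]
          exact eLpNorm_sub_dilation_le (hq i) (hb i) hR (ht i trivial).1 (ht i trivial).2
    _ = _ := by
        have h1 : volume (Metric.ball (0 : RSpace n) R) ^ (∑ i, L i) =
            ∏ i, volume (Metric.ball (0 : RSpace n) R) ^ L i := by
          induction (Finset.univ : Finset (Fin m)) using Finset.cons_induction with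
          | empty => simp
          | cons a s ha ih => rw [Finset.sum_cons, Finset.prod_cons, ENNReal.rpow_add _ _ hV0 hVt, ih]
        have hD : 0 ≤ dilationConst n := by unfold dilationConst; positivity
        rw [h1, dilationFactor, ENNReal.ofReal_prod_of_nonneg fun i _ => ?_,
          ← Finset.prod_mul_distrib, ← Finset.prod_mul_distrib, ← Finset.prod_mul_distrib]
        · refine Finset.prod_congr rfl fun i _ => ?_
          rw [ENNReal.ofReal_mul hD, ENNReal.ofReal_mul
            (Real.rpow_nonneg (ht i trivial).1.le _)]
          ring
        · exact mul_nonneg (Real.rpow_nonneg (ht i trivial).1.le _)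
            (log_two_div_pos (ht i trivial)).le

/-- Dividing the kernel by `dilationFactor` makes its sections uniformly bounded in `L^p`, and the
weight left over is exactly the density of `cesaroConst`. -/
lemma enorm_cesaroIntegrand {L : Fin m → ℝ} {ω : (Fin m → ℝ) → ℝ} (b f : Fin m → RSpace n → ℂ)
    (x : RSpace n) {t : Fin m → ℝ} (ht : t ∈ unitCube m) (hω : 0 ≤ ω t) :
    ‖cesaroIntegrand ω b f x t‖ₑ = cesaroDensity n L ω t *
      ((ENNReal.ofReal (dilationFactor n L t))⁻¹ *
        ((∏ i, ‖f i ((t i)⁻¹ • x)‖ₑ) * ∏ i, ‖b i x - b i ((t i)⁻¹ • x)‖ₑ)) := by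
  have ht0 (i : Fin m) : 0 < t i := (ht i trivial).1
  have hl := dilationFactor_pos (n := n) L ht
  have hl0 : ENNReal.ofReal (dilationFactor n L t) ≠ 0 := by simpa using hl
  have hdens : cesaroDensity n L ω t =
      ENNReal.ofReal (dilationFactor n L t) * ENNReal.ofReal ((∏ i, (t i ^ n)⁻¹) * ω t) := by
    rw [cesaroDensity, ← ENNReal.ofReal_mul hl.le, dilationFactor, Finset.prod_mul_distrib]
    congr 1
    have : ∏ i, t i ^ (-((n : ℝ) * L i) - (n : ℝ)) =
        (∏ i, t i ^ (-((n : ℝ) * L i))) * ∏ i, (t i ^ n)⁻¹ := by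
      rw [← Finset.prod_mul_distrib]
      refine Finset.prod_congr rfl fun i _ => ?_
      rw [Real.rpow_sub (ht0 i), Real.rpow_natCast, div_eq_mul_inv]
    rw [this]
    ring
  have hω' : ‖((ω t : ℝ) : ℂ)‖ₑ = ENNReal.ofReal (ω t) := by
    rw [← ofReal_norm, Complex.norm_real, Real.norm_of_nonneg hω]
  have hpow (i : Fin m) : ‖(((t i ^ n)⁻¹ : ℝ) : ℂ)‖ₑ = ENNReal.ofReal ((t i ^ n)⁻¹) := by
    rw [← ofReal_norm, Complex.norm_real,
      Real.norm_of_nonneg (inv_nonneg.2 (pow_nonneg (ht0 i).le n))]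
  have hprod {g : Fin m → ℂ} : ‖∏ i, g i‖ₑ = ∏ i, ‖g i‖ₑ := by
    simp only [← ofReal_norm, norm_prod]
    exact ENNReal.ofReal_prod_of_nonneg fun i _ => norm_nonneg _
  rw [hdens, cesaroIntegrand, enorm_mul, enorm_mul, hprod, hprod, hω']
  simp only [enorm_mul, hpow]
  rw [ENNReal.ofReal_mul (Finset.prod_nonneg fun i _ => inv_nonneg.2 (pow_nonneg (ht0 i).le n)),
    ENNReal.ofReal_prod_of_nonneg fun i _ => inv_nonneg.2 (pow_nonneg (ht0 i).le n),
    Finset.prod_mul_distrib]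
  calc _ = (ENNReal.ofReal (dilationFactor n L t) * (ENNReal.ofReal (dilationFactor n L t))⁻¹) *
        ((∏ i, ‖f i ((t i)⁻¹ • x)‖ₑ) * (∏ i, ENNReal.ofReal ((t i ^ n)⁻¹)) *
          (∏ i, ‖b i x - b i ((t i)⁻¹ • x)‖ₑ) * ENNReal.ofReal (ω t)) := by
        rw [ENNReal.mul_inv_cancel hl0 ENNReal.ofReal_ne_top, one_mul]
    _ = _ := by ring

lemma aemeasurable_cesaroDensity {L : Fin m → ℝ} {ω : (Fin m → ℝ) → ℝ}
    (hω : AEStronglyMeasurable ω (volume.restrict (unitCube m))) :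
    AEMeasurable (cesaroDensity n L ω) (volume.restrict (unitCube m)) := by
  unfold cesaroDensity
  refine AEMeasurable.ennreal_ofReal (AEMeasurable.mul (AEMeasurable.mul ?_ hω.aemeasurable) ?_)
  · exact Measurable.aemeasurable (by fun_prop)
  · exact Measurable.aemeasurable (by fun_prop)

lemma lintegral_cesaroIntegrand_rpow_le {p : ℝ} {P q L : Fin m → ℝ} (hp : 1 < p)
    (hP : ∀ i, p < P i) (hq : ∀ i, 1 < q i) (hpq : 1 / p = ∑ i, 1 / P i + ∑ i, 1 / q i)
    {ω : (Fin m → ℝ) → ℝ} (hω : AEStronglyMeasurable ω (volume.restrict (unitCube m)))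
    (hω0 : ∀ t ∈ unitCube m, 0 ≤ ω t)
    {b f : Fin m → RSpace n → ℂ} (hb : ∀ i, MemLpLoc (q i) (b i))
    (hf : ∀ i, MemLpLoc (P i) (f i)) {R : ℝ} (hR : 0 < R) :
    ∫⁻ x, (∫⁻ t in unitCube m, ‖cesaroIntegrand ω b f x t‖ₑ) ^ p ∂ballMeasure n R ≤
      (volume (Metric.ball (0 : RSpace n) R) ^ (∑ i, L i) *
          (∏ i, (morreyNorm (P i) (L i) (f i) *
            (ENNReal.ofReal (dilationConst n) * cmoNorm (q i) (b i)))) *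
          cesaroConst n L ω) ^ p := by
  -- Against this measure, of total mass `cesaroConst n L ω`, Minkowski applies with a bound
  -- independent of `t`.
  set ν := (volume.restrict (unitCube m)).withDensity (cesaroDensity n L ω) with hν
  have hνac : ν ≪ volume.restrict (unitCube m) := withDensity_absolutelyContinuous _ _
  have hν1 : ν Set.univ = cesaroConst n L ω := by
    rw [hν, withDensity_apply _ MeasurableSet.univ, Measure.restrict_univ]; rfl
  set g : (Fin m → ℝ) → RSpace n → ℝ≥0∞ := fun t x =>
    (ENNReal.ofReal (dilationFactor n L t))⁻¹ *
      ((∏ i, ‖f i ((t i)⁻¹ • x)‖ₑ) * ∏ i, ‖b i x - b i ((t i)⁻¹ • x)‖ₑ) with hg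
  have hgm : AEMeasurable (Function.uncurry g) (ν.prod (ballMeasure n R)) := by
    refine AEMeasurable.mono_ac ?_ (hνac.prod ballMeasure_absolutelyContinuous)
    refine AEMeasurable.mul ?_ (AEMeasurable.mul ?_ ?_)
    · unfold dilationFactor
      exact Measurable.aemeasurable (by fun_prop)
    · exact Finset.aemeasurable_fun_prod _ fun i _ =>
        (aestronglyMeasurable_comp_dilation (hf i).1 i).enorm
    · exact Finset.aemeasurable_fun_prod _ fun i _ =>
        ((hb i).1.comp_snd.sub (aestronglyMeasurable_comp_dilation (hb i).1 i)).enorm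
  have hint (x : RSpace n) :
      ∫⁻ t in unitCube m, ‖cesaroIntegrand ω b f x t‖ₑ = ∫⁻ t, g t x ∂ν := by
    rw [hν, lintegral_withDensity_eq_lintegral_mul_non_measurable₀ _ (aemeasurable_cesaroDensity hω)
      (ae_of_all _ fun t => ENNReal.ofReal_lt_top)]
    exact setLIntegral_congr_fun measurableSet_unitCube fun t ht =>
      enorm_cesaroIntegrand b f x ht (hω0 t ht)
  simp only [hint]
  rw [← hν1]
  refine lintegral_lintegral_rpow_le hgm hp (hνac.ae_le ?_)
  filter_upwards [ae_restrict_mem measurableSet_unitCube] with t ht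
  have hl : ENNReal.ofReal (dilationFactor n L t) ≠ 0 := by simpa using dilationFactor_pos L ht
  have hp0 : 0 ≤ p := by linarith
  simp only [hg, ENNReal.mul_rpow_of_nonneg _ _ hp0]
  rw [lintegral_const_mul' _ _
    (ENNReal.rpow_ne_top_of_nonneg hp0 (ENNReal.inv_ne_top.2 hl))]
  simp only [← ENNReal.mul_rpow_of_nonneg _ _ hp0]
  refine (mul_le_mul_right (lintegral_dilated_prod_rpow_le (L := L) hp hP hq hpq hb hf hR ht) _).trans_eq ?_
  rw [← ENNReal.mul_rpow_of_nonneg _ _ hp0, ← mul_assoc,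
    ENNReal.inv_mul_cancel hl ENNReal.ofReal_ne_top, one_mul]

theorem cesaroCommutatorBounded_of_cesaroConst_lt_top {p : ℝ} {P q L : Fin m → ℝ} (hp : 1 < p)
    (hP : ∀ i, p < P i) (hq : ∀ i, 1 < q i) (hpq : 1 / p = ∑ i, 1 / P i + ∑ i, 1 / q i)
    {ω : (Fin m → ℝ) → ℝ} (hω : AEStronglyMeasurable ω (volume.restrict (unitCube m)))
    (hω0 : ∀ t ∈ unitCube m, 0 ≤ ω t) (hfin : cesaroConst n L ω < ∞)
    {b : Fin m → RSpace n → ℂ} (hb : ∀ i, MemCMO (q i) (b i)) :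
    CesaroCommutatorBounded p (∑ i, L i) P L ω b := by
  have hp0 : 0 < p := zero_lt_one.trans hp
  set K : ℝ≥0∞ :=
    (∏ i, (ENNReal.ofReal (dilationConst n) * cmoNorm (q i) (b i))) * cesaroConst n L ω with hK
  have hKfin : K < ∞ := ENNReal.mul_lt_top
    (ENNReal.prod_lt_top fun i _ => ENNReal.mul_lt_top ENNReal.ofReal_lt_top (hb i).2) hfin
  refine ⟨K.toNNReal, fun f hf => ?_⟩
  rw [ENNReal.coe_toNNReal hKfin.ne]
  have hjoint := aestronglyMeasurable_cesaroIntegrand hω (fun i => (hb i).1.1) fun i => (hf i).1.1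
  have hmain (R : ℝ) (hR : 0 < R) :
      ∫⁻ x, (∫⁻ t in unitCube m, ‖cesaroIntegrand ω b f x t‖ₑ) ^ p ∂ballMeasure n R ≤
      (volume (Metric.ball (0 : RSpace n) R) ^ (∑ i, L i) *
        (K * ∏ i, morreyNorm (P i) (L i) (f i))) ^ p := by
    refine (lintegral_cesaroIntegrand_rpow_le (L := L) hp hP hq hpq hω hω0 (fun i => (hb i).1)
      (fun i => (hf i).1) hR).trans_eq ?_
    rw [hK, Finset.prod_mul_distrib]
    ring_nf
  have hBfin : K * ∏ i, morreyNorm (P i) (L i) (f i) < ∞ :=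
    ENNReal.mul_lt_top hKfin (ENNReal.prod_lt_top fun i _ => (hf i).2)
  have hRfin (R : ℝ) (hR : 0 < R) : volume (Metric.ball (0 : RSpace n) R) ^ (∑ i, L i) *
        (K * ∏ i, morreyNorm (P i) (L i) (f i)) < ∞ :=
    ENNReal.mul_lt_top (ENNReal.rpow_ne_top_of_ne_zero (volume_ball_ne_zero hR)
      volume_ball_ne_top).lt_top hBfin
  have hGm : AEStronglyMeasurable (cesaroCommutator ω b f) volume :=
    hjoint.prod_swap.integral_prod_right'
  have hGle (R : ℝ) (hR : 0 < R) :
      eLpNorm (cesaroCommutator ω b f) (ENNReal.ofReal p) (ballMeasure n R) ≤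
        volume (Metric.ball (0 : RSpace n) R) ^ (∑ i, L i) *
          (K * ∏ i, morreyNorm (P i) (L i) (f i)) := by
    rw [eLpNorm_ofReal_exponent hp0, one_div, ENNReal.rpow_inv_le_iff hp0]
    refine le_trans (lintegral_mono fun x => ?_) (hmain R hR)
    gcongr
    exact enorm_integral_le_lintegral_enorm _
  have hnorm : morreyNorm p (∑ i, L i) (cesaroCommutator ω b f) ≤
      K * ∏ i, morreyNorm (P i) (L i) (f i) := morreyNorm_le hp0 _ _ hGle
  refine ⟨?_, ⟨memLpLoc_of_eLpNorm_lt_top hGm fun R hR => (hGle R hR).trans_lt (hRfin R hR),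
    hnorm.trans_lt hBfin⟩, hnorm⟩
  have hFm : AEMeasurable (fun x => ∫⁻ t in unitCube m, ‖cesaroIntegrand ω b f x t‖ₑ) volume :=
    hjoint.enorm.prod_swap.lintegral_prod_right'
  -- A finite `L^p` mean on a ball makes the inner integral finite almost everywhere there;
  -- countably many balls exhaust the space.
  have hfinite : ∀ᵐ x : RSpace n, ∀ k : ℕ, x ∈ Metric.ball (0 : RSpace n) (k + 1) →
      ∫⁻ t in unitCube m, ‖cesaroIntegrand ω b f x t‖ₑ < ∞ := by
    refine ae_all_iff.2 fun k => ?_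
    have hk : (0 : ℝ) < k + 1 := by positivity
    rw [← ae_restrict_iff' measurableSet_ball]
    have h1 := hmain _ hk
    rw [lintegral_ballMeasure] at h1
    have h2 := (h1.trans_lt (ENNReal.rpow_lt_top_of_nonneg hp0.le (hRfin _ hk).ne)).ne
    have h3 := ae_lt_top' (hFm.restrict.pow_const p) fun h4 => h2 (by
      rw [h4, ENNReal.top_div_of_ne_top volume_ball_ne_top])
    filter_upwards [h3] with x hx
    exact (ENNReal.rpow_lt_top_iff_of_pos hp0).1 hx
  filter_upwards [hfinite, hjoint.prod_swap.prodMk_left] with x hx hxm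
  obtain ⟨k, hk⟩ := exists_nat_gt ‖x‖
  exact ⟨hxm, hx k (by simpa using hk.trans (lt_add_one _))⟩

end Sufficiency

/-! ### Test functions: radial powers and logarithmic symbols -/

section TestFunctions

variable {n : ℕ}

lemma integrableOn_ball_norm_rpow (hn : 1 ≤ n) {a : ℝ} (ha : -(n : ℝ) < a) :
    IntegrableOn (fun x : RSpace n => ‖x‖ ^ a) (Metric.ball 0 1) := by
  have : Nonempty (Fin n) := ⟨⟨0, hn⟩⟩
  rw [integrableOn_fun_norm_addHaar volume (f := fun y : ℝ => y ^ a)]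
  have h : IntegrableOn (fun y : ℝ => y ^ ((n : ℝ) - 1 + a)) (Set.Ioo 0 1) :=
    (intervalIntegral.integrableOn_Ioo_rpow_iff one_pos).2 (by linarith)
  refine h.congr_fun (fun y hy => ?_) measurableSet_Ioo
  simp only [finrank_euclideanSpace, Fintype.card_fin, smul_eq_mul]
  rw [← Real.rpow_natCast, ← Real.rpow_add hy.1, Nat.cast_sub hn, Nat.cast_one]

lemma eLpNorm_lt_top_of_enorm_rpow_le (hn : 1 ≤ n) {p a : ℝ} (hp : 0 < p) (ha : -(n : ℝ) < a)
    {f : RSpace n → ℂ} {C : ℝ≥0∞} (hC : C < ∞)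
    (h : ∀ x : RSpace n, x ≠ 0 → ‖x‖ < 1 → ‖f x‖ₑ ^ p ≤ C * ENNReal.ofReal (‖x‖ ^ a)) :
    eLpNorm f (ENNReal.ofReal p) (ballMeasure n 1) < ∞ := by
  have : Nonempty (Fin n) := ⟨⟨0, hn⟩⟩
  rw [eLpNorm_ballMeasure hp]
  refine ENNReal.rpow_lt_top_of_nonneg (by positivity) (ENNReal.div_lt_top ?_
    (volume_ball_ne_zero one_pos)).ne
  have hne : ∀ᵐ x : RSpace n, x ≠ 0 := by
    rw [ae_iff]; simp
  have hle : ∫⁻ x in Metric.ball (0 : RSpace n) 1, ‖f x‖ₑ ^ p ≤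
      ∫⁻ x in Metric.ball (0 : RSpace n) 1, C * ENNReal.ofReal (‖x‖ ^ a) := by
    refine lintegral_mono_ae ?_
    filter_upwards [ae_restrict_mem measurableSet_ball, ae_restrict_of_ae hne] with x hx hx0
    exact h x hx0 (by simpa using hx)
  refine (hle.trans_lt ?_).ne
  rw [lintegral_const_mul' _ _ hC.ne]
  have hi := (integrableOn_ball_norm_rpow hn ha).2
  refine ENNReal.mul_lt_top hC (lt_of_le_of_lt (lintegral_mono fun x => ?_) hi)
  rw [← ofReal_norm, Real.norm_of_nonneg (Real.rpow_nonneg (norm_nonneg x) a)]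

/-- The radial power `|x|^{n lam}`. -/
noncomputable def radialPower (n : ℕ) (lam : ℝ) (x : RSpace n) : ℂ :=
  ((‖x‖ ^ ((n : ℝ) * lam) : ℝ) : ℂ)

lemma measurable_radialPower (lam : ℝ) : Measurable (radialPower n lam) := by
  unfold radialPower; fun_prop

/-- Homogeneity of degree `n lam` makes the Morrey quotient independent of the radius, so only
integrability on the unit ball matters, and `lam > -1/P` gives it. -/
lemma memMorrey_radialPower (hn : 1 ≤ n) {P lam : ℝ} (hP : 0 < P) (h : -(1 / P) < lam) :
    MemMorrey P lam (radialPower n lam) := by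
  have hn0 : (0 : ℝ) < n := by exact_mod_cast hn
  set A := eLpNorm (radialPower n lam) (ENNReal.ofReal P) (ballMeasure n 1)
  have hA : A < ∞ := by
    refine eLpNorm_lt_top_of_enorm_rpow_le hn hP (a := n * lam * P) (C := 1) ?_ (by simp) ?_
    · have h1 : -1 < lam * P := by
        have := mul_lt_mul_of_pos_right h hP
        rwa [neg_mul, one_div_mul_cancel hP.ne'] at this
      nlinarith
    · intro x _ _
      rw [one_mul, radialPower, ← ofReal_norm, Complex.norm_real,
        Real.norm_of_nonneg (Real.rpow_nonneg (norm_nonneg x) _),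
        ENNReal.ofReal_rpow_of_nonneg (Real.rpow_nonneg (norm_nonneg x) _) hP.le,
        ← Real.rpow_mul (norm_nonneg x)]
  have hV0 := volume_ball_ne_zero (n := n) one_pos
  have hVt := volume_ball_ne_top (n := n) (R := 1)
  have hR (R : ℝ) (hR : 0 < R) :
      eLpNorm (radialPower n lam) (ENNReal.ofReal P) (ballMeasure n R) =
        ENNReal.ofReal (R ^ ((n : ℝ) * lam)) * A := by
    have h1 := eLpNorm_comp_smul hR one_pos (ENNReal.ofReal P) (radialPower n lam)
    rw [mul_one] at h1
    have h2 : (fun x => radialPower n lam (R • x)) =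
        ((R ^ ((n : ℝ) * lam) : ℝ) : ℂ) • radialPower n lam := by
      ext x
      simp only [radialPower, norm_smul, Real.norm_of_nonneg hR.le, Pi.smul_apply, smul_eq_mul]
      rw [Real.mul_rpow hR.le (norm_nonneg x), Complex.ofReal_mul]
    rw [← h1, h2, eLpNorm_const_smul, ← ofReal_norm, Complex.norm_real,
      Real.norm_of_nonneg (Real.rpow_nonneg hR.le _)]
  refine ⟨memLpLoc_of_eLpNorm_lt_top (measurable_radialPower lam).aestronglyMeasurable fun R h0 => ?_,
    (morreyNorm_le (A := volume (Metric.ball (0 : RSpace n) 1) ^ (-lam) * A) hP _ _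
      fun R h0 => ?_).trans_lt ?_⟩
  · rw [hR R h0]
    exact ENNReal.mul_lt_top ENNReal.ofReal_lt_top hA
  · have := volume_ball_inv_mul_rpow (n := n) (inv_pos.2 h0) 1 lam
    rw [inv_inv, mul_one, Real.rpow_neg (inv_pos.2 h0).le, Real.inv_rpow h0.le, inv_inv] at this
    rw [hR R h0, this, mul_assoc, ← mul_assoc (_ ^ lam), ← ENNReal.rpow_add _ _ hV0 hVt]
    simp
  · exact ENNReal.mul_lt_top (ENNReal.rpow_ne_top_of_ne_zero hV0 hVt).lt_top hA

/-- The symbol `log |x| + i u(x)`. -/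
noncomputable def logSymbol (u : RSpace n → ℝ) (x : RSpace n) : ℂ :=
  ((Real.log ‖x‖ : ℝ) : ℂ) + Complex.I * ((u x : ℝ) : ℂ)

lemma eLpNorm_log_norm_lt_top (hn : 1 ≤ n) {q : ℝ} (hq : 0 < q) :
    eLpNorm (fun x : RSpace n => ((Real.log ‖x‖ : ℝ) : ℂ)) (ENNReal.ofReal q) (ballMeasure n 1) <
      ∞ := by
  have hn1 : (1 : ℝ) ≤ n := by exact_mod_cast hn
  -- From `|log r| ≤ 2q r^(-1/(2q))` for `0 < r < 1`; the `q`-th power has exponent `-1/2`, above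
  -- `-n` in every dimension.
  refine eLpNorm_lt_top_of_enorm_rpow_le hn hq (a := -(1 / 2))
    (C := ENNReal.ofReal ((2 * q) ^ q)) (by linarith) ENNReal.ofReal_lt_top fun x hx hx1 => ?_
  have hx0 : 0 < ‖x‖ := norm_pos_iff.2 hx
  rw [← ofReal_norm, Complex.norm_real, ENNReal.ofReal_rpow_of_nonneg (norm_nonneg _) hq.le,
    ← ENNReal.ofReal_mul (by positivity)]
  refine ENNReal.ofReal_le_ofReal ?_
  have h := (Real.abs_log_mul_self_rpow_lt ‖x‖ (1 / (2 * q)) hx0 hx1.le (by positivity)).le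
  rw [abs_mul, abs_of_pos (Real.rpow_pos_of_pos hx0 _), one_div_one_div] at h
  have h2 : ‖Real.log ‖x‖‖ ≤ 2 * q * ‖x‖ ^ (-(1 / (2 * q))) := by
    rw [Real.rpow_neg hx0.le, ← div_eq_mul_inv, le_div_iff₀ (Real.rpow_pos_of_pos hx0 _)]
    exact h
  calc _ ≤ (2 * q * ‖x‖ ^ (-(1 / (2 * q)))) ^ q := by gcongr
    _ = _ := by
      rw [Real.mul_rpow (by positivity) (by positivity), ← Real.rpow_mul hx0.le]
      congr 2
      field_simp

/-- With `log R` as the constant on `B(0,R)`, rescaling to the unit ball removes `R` from the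
logarithmic part; the bounded part adds at most `B`. -/
lemma memCMO_logSymbol (hn : 1 ≤ n) {q : ℝ} (hq : 1 < q) {u : RSpace n → ℝ} (hu : Measurable u)
    {B : ℝ} (hB : ∀ x, |u x| ≤ B) : MemCMO q (logSymbol u) := by
  have : Nonempty (Fin n) := ⟨⟨0, hn⟩⟩
  have hq0 : 0 < q := zero_lt_one.trans hq
  have hm1 : Measurable fun x : RSpace n => ((Real.log ‖x‖ : ℝ) : ℂ) := by fun_prop
  have hm2 : Measurable fun x : RSpace n => Complex.I * ((u x : ℝ) : ℂ) := by fun_prop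
  refine memCMO_of_eLpNorm_sub_le hq (hm1.add hm2).aestronglyMeasurable
    (ENNReal.add_lt_top.2 ⟨eLpNorm_log_norm_lt_top hn hq0, ENNReal.ofReal_lt_top (r := B)⟩)
    fun R hR => ⟨((Real.log R : ℝ) : ℂ), ?_⟩
  have := isProbabilityMeasure_ballMeasure (n := n) hR
  have hsplit : (fun x => logSymbol u x - ((Real.log R : ℝ) : ℂ)) =
      (fun x => ((Real.log ‖x‖ : ℝ) : ℂ) - ((Real.log R : ℝ) : ℂ)) +
        fun x => Complex.I * ((u x : ℝ) : ℂ) := by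
    ext x
    simp only [logSymbol, Pi.add_apply]
    ring
  rw [hsplit]
  refine (eLpNorm_add_le (hm1.sub_const _).aestronglyMeasurable hm2.aestronglyMeasurable
    (one_le_ofReal_of_one_lt hq)).trans (add_le_add ?_ ?_)
  · have h1 := eLpNorm_comp_smul hR one_pos (ENNReal.ofReal q)
      fun x : RSpace n => ((Real.log ‖x‖ : ℝ) : ℂ) - ((Real.log R : ℝ) : ℂ)
    rw [mul_one] at h1
    rw [← h1]
    refine (eLpNorm_congr_ae ?_).le
    have hne : ∀ᵐ x : RSpace n, x ≠ 0 := by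
      rw [ae_iff]; simp
    filter_upwards [ballMeasure_absolutelyContinuous.ae_le hne] with x hx
    rw [norm_smul, Real.norm_of_nonneg hR.le, Real.log_mul hR.ne' (norm_ne_zero_iff.2 hx)]
    push_cast
    ring
  · refine (eLpNorm_le_of_ae_bound (C := B) (ae_of_all _ fun x => ?_)).trans ?_
    · simpa using hB x
    · simp

end TestFunctions

/-! ### Ternary encoding of bit sequences -/

section Digits

/-- The real number with ternary digits `0` and `1` prescribed by `c`. -/
noncomputable def digitSum (c : ℕ → Bool) : ℝ := ∑' k, if c k then (1 / 3 : ℝ) ^ k else 0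

lemma summable_digits (c : ℕ → Bool) : Summable fun k => if c k then (1 / 3 : ℝ) ^ k else 0 := by
  refine Summable.of_nonneg_of_le (fun k => ?_) (fun k => ?_)
    (summable_geometric_of_lt_one (by norm_num : (0 : ℝ) ≤ 1 / 3) (by norm_num))
  · split_ifs <;> positivity
  · split_ifs
    · exact le_rfl
    · positivity

lemma abs_digitSum_le (c : ℕ → Bool) : |digitSum c| ≤ 3 / 2 := by
  have h0 : 0 ≤ digitSum c := tsum_nonneg fun k => by split_ifs <;> positivity
  rw [abs_of_nonneg h0]
  refine ((summable_digits c).tsum_le_tsum (fun k => ?_)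
    (summable_geometric_of_lt_one (by norm_num : (0 : ℝ) ≤ 1 / 3) (by norm_num))).trans ?_
  · split_ifs
    · exact le_rfl
    · positivity
  · rw [tsum_geometric_of_lt_one (by norm_num) (by norm_num)]
    norm_num

/-- At the first differing index `j ≤ k` the terms differ by `3^(-j)`, while all later ones together
contribute at most `3^(-j)/2`. Base `2` would leave no margin. -/
lemma half_pow_le_abs_digitSum_sub {c c' : ℕ → Bool} {k : ℕ} (h : c k ≠ c' k) :
    (1 / 3 : ℝ) ^ k / 2 ≤ |digitSum c - digitSum c'| := by
  classical
  have hex : ∃ j, c j ≠ c' j := ⟨k, h⟩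
  set j := Nat.find hex
  have hjk : j ≤ k := Nat.find_min' hex h
  have hj : c j ≠ c' j := Nat.find_spec hex
  set d : ℕ → ℝ := fun l => (if c l then (1 / 3 : ℝ) ^ l else 0) -
    (if c' l then (1 / 3 : ℝ) ^ l else 0) with hd
  have hds : Summable d := (summable_digits c).sub (summable_digits c')
  have hsum : digitSum c - digitSum c' = ∑' l, d l :=
    ((summable_digits c).tsum_sub (summable_digits c')).symm
  have hdle (l : ℕ) : |d l| ≤ (1 / 3 : ℝ) ^ l := by
    have : (0 : ℝ) ≤ (1 / 3 : ℝ) ^ l := by positivity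
    simp only [hd]
    split_ifs <;> simp
  have hdj : |d j| = (1 / 3 : ℝ) ^ j := by
    have : (0 : ℝ) ≤ (1 / 3 : ℝ) ^ j := by positivity
    simp only [hd]
    cases h1 : c j <;> cases h2 : c' j <;> simp_all
  have hd0 (l : ℕ) (hl : l ∈ Finset.range j) : d l = 0 := by
    have : c l = c' l := not_not.1 (Nat.find_min hex (Finset.mem_range.1 hl))
    simp [hd, this]
  have htail : |∑' l, d (l + (j + 1))| ≤ (1 / 3 : ℝ) ^ j / 2 := by
    have hg : HasSum (fun l : ℕ => (1 / 3 : ℝ) ^ (l + (j + 1))) ((1 / 3 : ℝ) ^ j / 2) := by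
      have := (hasSum_geometric_of_lt_one (by norm_num : (0 : ℝ) ≤ 1 / 3)
        (by norm_num)).mul_right ((1 / 3 : ℝ) ^ (j + 1))
      have h2 : (1 - 1 / 3 : ℝ)⁻¹ * (1 / 3) ^ (j + 1) = (1 / 3 : ℝ) ^ j / 2 := by
        rw [pow_succ]; norm_num; ring
      rw [h2] at this
      simpa only [pow_add _ _ (j + 1)] using this
    rw [← hg.tsum_eq, ← Real.norm_eq_abs]
    exact tsum_of_norm_bounded hg.summable.hasSum fun l => hdle _
  rw [hsum, ← hds.sum_add_tsum_nat_add (j + 1), Finset.sum_range_succ, Finset.sum_eq_zero hd0,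
    zero_add]
  have h1 := abs_sub_abs_le_abs_sub (d j) (-∑' l, d (l + (j + 1)))
  rw [abs_neg, sub_neg_eq_add, hdj] at h1
  have h2 : (1 / 3 : ℝ) ^ k ≤ (1 / 3 : ℝ) ^ j :=
    pow_le_pow_of_le_one (by norm_num) (by norm_num) hjk
  linarith

lemma measurable_digitSum {α : Type*} [MeasurableSpace α] {χ : ℕ → α → Bool}
    (hχ : ∀ k, Measurable (χ k)) : Measurable fun x => digitSum fun k => χ k x := by
  have hterm (k : ℕ) : Measurable fun x => if χ k x then (1 / 3 : ℝ) ^ k else 0 :=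
    Measurable.ite (hχ k (measurableSet_singleton true)) measurable_const measurable_const
  refine measurable_of_tendsto_metrizable
    (f := fun N x => ∑ k ∈ Finset.range N, if χ k x then (1 / 3 : ℝ) ^ k else 0)
    (fun N => Finset.measurable_fun_sum _ fun k _ => hterm k) ?_
  exact tendsto_pi_nhds.2 fun x => (summable_digits fun k => χ k x).hasSum.tendsto_sum_nat

end Digits

/-! ### Averaging over random bits -/

section RandomBits

/-- The indicator that two bits differ. -/
noncomputable def bitDiff (p : Bool × Bool) : ℝ≥0∞ := if p.1 ≠ p.2 then 1 else 0

lemma bitDiff_le_one (p : Bool × Bool) : bitDiff p ≤ 1 := by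
  unfold bitDiff; split_ifs <;> simp

/-- Flipping bit `a` is an involution that exchanges agreement and disagreement with bit `b`. -/
lemma two_mul_sum_bitDiff {M : ℕ} {a b : Fin M} (hab : a ≠ b) :
    2 * ∑ c : Fin M → Bool, bitDiff (c a, c b) = Fintype.card (Fin M → Bool) := by
  let flip : (Fin M → Bool) ≃ (Fin M → Bool) := Function.Involutive.toPerm
    (fun c => Function.update c a (!c a)) fun c => by simp
  have h : ∑ c : Fin M → Bool, bitDiff (c a, c b) =
      ∑ c : Fin M → Bool, bitDiff (!c a, c b) := by
    rw [← flip.sum_comp]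
    refine Finset.sum_congr rfl fun c _ => ?_
    change bitDiff (Function.update c a (!c a) a, Function.update c a (!c a) b) = _
    rw [Function.update_self, Function.update_of_ne hab.symm]
  rw [two_mul]
  nth_rewrite 2 [h]
  rw [← Finset.sum_add_distrib]
  have h1 (c : Fin M → Bool) : bitDiff (c a, c b) + bitDiff (!c a, c b) = 1 := by
    unfold bitDiff
    cases c a <;> cases c b <;> simp
  simp [h1]

/-- Different `i` use independent colourings, so the sum of products factors into a product of sums.
-/
lemma card_mul_prod_le_sum_prod_bitDiff {m M : ℕ} {a : Fin M} {b : Fin m → Fin M}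
    (hab : ∀ i, a ≠ b i) (τ : Fin m → ℝ≥0∞) :
    (Fintype.card (Fin m → Fin M → Bool) : ℝ≥0∞) * ∏ i, (τ i + 2⁻¹) ≤
      ∑ c : Fin m → Fin M → Bool, ∏ i, (τ i + bitDiff (c i a, c i (b i))) := by
  have h1 (i : Fin m) : ∑ c : Fin M → Bool, (τ i + bitDiff (c a, c (b i))) =
      Fintype.card (Fin M → Bool) * (τ i + 2⁻¹) := by
    have h3 : (Fintype.card (Fin M → Bool) : ℝ≥0∞) * 2⁻¹ =
        ∑ c : Fin M → Bool, bitDiff (c a, c (b i)) := by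
      rw [← two_mul_sum_bitDiff (hab i), mul_comm, ← mul_assoc,
        ENNReal.inv_mul_cancel two_ne_zero ENNReal.ofNat_ne_top, one_mul]
    rw [Finset.sum_add_distrib, mul_add, h3]
    simp
  have h2 : ∏ i, ∑ c : Fin M → Bool, (τ i + bitDiff (c a, c (b i))) =
      ∑ c : Fin m → Fin M → Bool, ∏ i, (τ i + bitDiff (c i a, c i (b i))) := by
    rw [Finset.prod_univ_sum, Fintype.piFinset_univ]
  rw [← h2]
  simp only [h1]
  rw [Finset.prod_mul_distrib]
  simp

end RandomBits

/-! ### Bits that oscillate on a compact part of the cube -/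

section Oscillation

variable {m n : ℕ}

/-- The annulus `1 < |x| < 2`. -/
def annulus (n : ℕ) : Set (RSpace n) := {x | 1 < ‖x‖ ∧ ‖x‖ < 2}

lemma isOpen_annulus : IsOpen (annulus n) :=
  (isOpen_lt continuous_const continuous_norm).inter (isOpen_lt continuous_norm continuous_const)

lemma volume_annulus_ne_zero (hn : 1 ≤ n) : volume (annulus n) ≠ 0 := by
  have : Nonempty (Fin n) := ⟨⟨0, hn⟩⟩
  obtain ⟨x, hx⟩ := exists_norm_eq (RSpace n) (by norm_num : (0 : ℝ) ≤ 3 / 2)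
  exact (isOpen_annulus.measure_pos volume ⟨x, by rw [hx]; norm_num, by rw [hx]; norm_num⟩).ne'

lemma volume_annulus_ne_top : volume (annulus n) ≠ ∞ :=
  (measure_mono_top (fun x hx => by simpa using hx.2 :
    annulus n ⊆ Metric.ball 0 2)).mt volume_ball_ne_top

/-- The oscillation integrand of a family of bit-valued functions. -/
noncomputable def bitKernel (χ : Fin m → RSpace n → Bool) (x : RSpace n) (t : Fin m → ℝ) : ℝ≥0∞ :=
  ∏ i, (ENNReal.ofReal (Real.log (t i)⁻¹) + bitDiff (χ i x, χ i ((t i)⁻¹ • x)))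

lemma measurable_bitKernel {χ : Fin m → RSpace n → Bool} (hχ : ∀ i, Measurable (χ i)) :
    Measurable (Function.uncurry (bitKernel χ)) := by
  unfold bitKernel Function.uncurry
  refine Finset.measurable_fun_prod _ fun i _ => ?_
  have hlog : Measurable fun z : RSpace n × (Fin m → ℝ) =>
      ENNReal.ofReal (Real.log (z.2 i)⁻¹) := by fun_prop
  refine hlog.add ?_
  have h : Measurable bitDiff := measurable_of_countable _
  refine h.comp (((hχ i).comp measurable_fst).prodMk ((hχ i).comp ?_))
  fun_prop

/-- The bound holds on average over all assignments of bits to the finitely many cells, hence for at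
least one. -/
lemma exists_bits_lintegral_bitKernel_ge {ν : Measure (Fin m → ℝ)} [SFinite ν]
    {K : Set (Fin m → ℝ)} (hK : MeasurableSet K) (hKc : K ⊆ unitCube m) {M : ℕ}
    {κ : RSpace n → Fin M} (hκ : Measurable κ)
    (hsep : ∀ x ∈ annulus n, ∀ t ∈ K, ∀ i, κ x ≠ κ ((t i)⁻¹ • x)) :
    ∃ χ : Fin m → RSpace n → Bool, (∀ i, Measurable (χ i)) ∧
      volume (annulus n) * ((2⁻¹ : ℝ≥0∞) ^ m *
          ∫⁻ t in K, ∏ i, ENNReal.ofReal (Real.log (2 / t i)) ∂ν) ≤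
        ∫⁻ x in annulus n, ∫⁻ t in K, bitKernel χ x t ∂ν := by
  set A := ∫⁻ t in K, ∏ i, ENNReal.ofReal (Real.log (2 / t i)) ∂ν
  set N : ℝ≥0∞ := (Fintype.card (Fin m → Fin M → Bool) : ℝ≥0∞) with hN
  have hmeas (c : Fin m → Fin M → Bool) (i : Fin m) : Measurable fun x => c i (κ x) :=
    (measurable_of_countable (c i)).comp hκ
  by_contra! hcon
  have hlt (c : Fin m → Fin M → Bool) := hcon (fun i x => c i (κ x)) (hmeas c)
  have hsum := ENNReal.sum_lt_sum_of_nonempty (s := Finset.univ) Finset.univ_nonempty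
    fun c _ => hlt c
  rw [Finset.sum_const, nsmul_eq_mul, Finset.card_univ, ← hN] at hsum
  refine hsum.not_ge ?_
  have hk (c : Fin m → Fin M → Bool) := measurable_bitKernel (hmeas c)
  have hk' (c : Fin m → Fin M → Bool) :
      Measurable fun x => ∫⁻ t in K, bitKernel (fun i x => c i (κ x)) x t ∂ν :=
    (hk c).lintegral_prod_right'
  rw [← lintegral_finsetSum _ fun c _ => hk' c]
  have hin (x : RSpace n) : ∑ c : Fin m → Fin M → Bool,
      ∫⁻ t in K, bitKernel (fun i x => c i (κ x)) x t ∂ν =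
      ∫⁻ t in K, ∑ c : Fin m → Fin M → Bool, bitKernel (fun i x => c i (κ x)) x t ∂ν :=
    (lintegral_finsetSum _ fun c _ => (hk c).comp measurable_prodMk_left).symm
  simp only [hin]
  calc N * (volume (annulus n) * (2⁻¹ ^ m * A))
      = ∫⁻ x in annulus n, N * (2⁻¹ ^ m * A) := by
        rw [setLIntegral_const]; ring
    _ ≤ _ := ?_
  refine setLIntegral_mono' isOpen_annulus.measurableSet fun x hx => ?_
  rw [← mul_assoc, ← lintegral_const_mul' _ _ (by finiteness)]
  refine setLIntegral_mono' hK fun t ht => ?_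
  refine le_trans ?_ (card_mul_prod_le_sum_prod_bitDiff (hsep x hx t ht) _)
  rw [mul_assoc, ← hN]
  gcongr
  calc (2⁻¹ : ℝ≥0∞) ^ m * ∏ i, ENNReal.ofReal (Real.log (2 / t i))
      = ∏ i, 2⁻¹ * ENNReal.ofReal (Real.log (2 / t i)) := by
        rw [Finset.prod_mul_distrib]; simp
    _ ≤ _ := ?_
  gcongr with i _
  have ht0 := (hKc ht i trivial).1
  have hlogt : 0 ≤ Real.log (t i)⁻¹ :=
    Real.log_nonneg ((one_le_inv₀ ht0).2 (hKc ht i trivial).2.le)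
  have h2 : (2⁻¹ : ℝ≥0∞) = ENNReal.ofReal 2⁻¹ := by
    rw [ENNReal.ofReal_inv_of_pos two_pos]; simp
  rw [h2, ← ENNReal.ofReal_mul (by norm_num), ← ENNReal.ofReal_add hlogt (by norm_num)]
  refine ENNReal.ofReal_le_ofReal ?_
  rw [div_eq_mul_inv, Real.log_mul two_ne_zero (inv_ne_zero ht0.ne')]
  linarith [Real.log_two_lt_d9]

/-- Shells of width `δ` in `log |x|`: passing from `x` to `x/tᵢ` raises `log |x|` by at least `δ`,
hence the shell index by at least `1`. -/
lemma exists_separating_cells {K : Set (Fin m → ℝ)} {δ T : ℝ} (hδ : 0 < δ)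
    (hK : ∀ t ∈ K, ∀ i, 0 < t i ∧ δ ≤ Real.log (t i)⁻¹ ∧ Real.log (t i)⁻¹ ≤ T) :
    ∃ (M : ℕ) (κ : RSpace n → Fin M), Measurable κ ∧
      ∀ x ∈ annulus n, ∀ t ∈ K, ∀ i, κ x ≠ κ ((t i)⁻¹ • x) := by
  -- On the annulus `log |x| ≤ 1`, so `N` bounds the indices of both `x` and `x/tᵢ`; reduction
  -- modulo `N + 1` leaves them unchanged.
  set N := ⌊(1 + T) / δ⌋₊
  refine ⟨N + 1, fun x => Fin.ofNat (N + 1) ⌊Real.log ‖x‖ / δ⌋₊, ?_, fun x hx t ht i heq => ?_⟩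
  · exact (measurable_of_countable fun k : ℕ => Fin.ofNat (N + 1) k).comp
      (Nat.measurable_floor.comp (by fun_prop))
  · obtain ⟨ht0, h1, h2⟩ := hK t ht i
    have hx0 : 0 < ‖x‖ := zero_lt_one.trans hx.1
    have hlog0 : 0 ≤ Real.log ‖x‖ := Real.log_nonneg hx.1.le
    have hlog1 : Real.log ‖x‖ ≤ 1 := by
      have := Real.log_le_log hx0 hx.2.le
      linarith [Real.log_two_lt_d9]
    have hlog : Real.log ‖(t i)⁻¹ • x‖ = Real.log ‖x‖ + Real.log (t i)⁻¹ := by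
      rw [norm_smul, Real.norm_of_nonneg (inv_nonneg.2 ht0.le),
        Real.log_mul (inv_ne_zero ht0.ne') hx0.ne', add_comm]
    have hle : ⌊Real.log ‖x‖ / δ⌋₊ + 1 ≤ ⌊Real.log ‖(t i)⁻¹ • x‖ / δ⌋₊ := by
      rw [← Nat.floor_add_one (by positivity)]
      refine Nat.floor_le_floor ?_
      rw [hlog, div_add_one hδ.ne']
      gcongr
    have hub : ⌊Real.log ‖(t i)⁻¹ • x‖ / δ⌋₊ ≤ N := by
      refine Nat.floor_le_floor ?_
      rw [hlog]
      gcongr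
    have hval := congrArg Fin.val heq
    simp only [Fin.val_ofNat] at hval
    rw [Nat.mod_eq_of_lt (by omega), Nat.mod_eq_of_lt (by omega)] at hval
    omega

end Oscillation

/-! ### One bounded family of functions forcing divergence -/

section Divergence

variable {m n : ℕ}

lemma ofReal_log_inv_add_bitDiff_le {t : ℝ} (ht : t ∈ Set.Ioo (0 : ℝ) 1) (p : Bool × Bool) :
    ENNReal.ofReal (Real.log t⁻¹) + bitDiff p ≤ 2 * ENNReal.ofReal (Real.log (2 / t)) := by
  have hlogt : 0 ≤ Real.log t⁻¹ := Real.log_nonneg ((one_le_inv₀ ht.1).2 ht.2.le)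
  calc _ ≤ ENNReal.ofReal (Real.log t⁻¹) + ENNReal.ofReal 1 := by
        gcongr; simpa using bitDiff_le_one p
    _ = ENNReal.ofReal (Real.log t⁻¹ + 1) := (ENNReal.ofReal_add hlogt zero_le_one).symm
    _ ≤ ENNReal.ofReal (2 * Real.log (2 / t)) := by
        refine ENNReal.ofReal_le_ofReal ?_
        rw [div_eq_mul_inv, Real.log_mul two_ne_zero (inv_ne_zero ht.1.ne')]
        linarith [Real.log_two_gt_d9]
    _ = _ := by rw [ENNReal.ofReal_mul zero_le_two]; simp

lemma ofReal_log_inv_add_bitDiff_le_digitSum {t : ℝ} (ht : t ∈ Set.Ioo (0 : ℝ) 1)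
    (c c' : ℕ → Bool) (k : ℕ) :
    ENNReal.ofReal (Real.log t⁻¹) + bitDiff (c k, c' k) ≤
      2 * 3 ^ k * ENNReal.ofReal (Real.log t⁻¹ + |digitSum c - digitSum c'|) := by
  have hlogt : 0 ≤ Real.log t⁻¹ := Real.log_nonneg ((one_le_inv₀ ht.1).2 ht.2.le)
  have h3 : (1 : ℝ) ≤ 3 ^ k := one_le_pow₀ (by norm_num)
  have hr : (2 * 3 ^ k : ℝ≥0∞) = ENNReal.ofReal (2 * 3 ^ k) := by
    rw [ENNReal.ofReal_mul zero_le_two, ENNReal.ofReal_pow (by norm_num)]; simp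
  rw [hr, ← ENNReal.ofReal_mul (by positivity)]
  have habs := abs_nonneg (digitSum c - digitSum c')
  unfold bitDiff
  split_ifs with h
  · rw [← ENNReal.ofReal_one, ← ENNReal.ofReal_add hlogt zero_le_one]
    refine ENNReal.ofReal_le_ofReal ?_
    have h1 := half_pow_le_abs_digitSum_sub h
    have h2 : 1 ≤ 2 * 3 ^ k * |digitSum c - digitSum c'| := by
      calc (1 : ℝ) = 2 * 3 ^ k * ((1 / 3) ^ k / 2) := by
            rw [one_div, inv_pow]; field_simp
        _ ≤ _ := by gcongr
    nlinarith
  · rw [add_zero]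
    refine ENNReal.ofReal_le_ofReal ?_
    nlinarith

/-- The oscillation integrand of the symbols `log |x| + i uᵢ(x)`, up to constants. -/
noncomputable def oscillationKernel (u : Fin m → RSpace n → ℝ) (x : RSpace n) (t : Fin m → ℝ) :
    ℝ≥0∞ :=
  ∏ i, ENNReal.ofReal (Real.log (t i)⁻¹ + |u i x - u i ((t i)⁻¹ • x)|)

lemma exists_bounded_oscillation_diverges (hn : 1 ≤ n) {ν : Measure (Fin m → ℝ)} [SFinite ν]
    {K : ℕ → Set (Fin m → ℝ)} (hKm : ∀ j, MeasurableSet (K j)) (hmono : Monotone K)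
    (hKu : ⋃ j, K j = unitCube m)
    (hKb : ∀ j, ∃ δ T : ℝ, 0 < δ ∧
      ∀ t ∈ K j, ∀ i, 0 < t i ∧ δ ≤ Real.log (t i)⁻¹ ∧ Real.log (t i)⁻¹ ≤ T)
    (hfin : ∀ j, ∫⁻ t in K j, ∏ i, ENNReal.ofReal (Real.log (2 / t i)) ∂ν < ∞)
    (htop : ∫⁻ t in unitCube m, ∏ i, ENNReal.ofReal (Real.log (2 / t i)) ∂ν = ∞) :
    ∃ u : Fin m → RSpace n → ℝ, (∀ i, Measurable (u i)) ∧ (∀ i x, |u i x| ≤ 3 / 2) ∧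
      ¬ ∀ᵐ x : RSpace n, ∫⁻ t in unitCube m, oscillationKernel u x t ∂ν < ∞ := by
  have hKc (j : ℕ) : K j ⊆ unitCube m := hKu ▸ Set.subset_iUnion K j
  have hsup : ⨆ j, ∫⁻ t in K j, ∏ i, ENNReal.ofReal (Real.log (2 / t i)) ∂ν = ∞ := by
    rw [← htop, ← hKu, setLIntegral_iUnion_of_directed _ hmono.directed_le]
  -- `(2 * 3 ^ k) ^ m` pays for reading the `k`-th digit in each of the `m` factors; the extra `2 ^
  -- k` makes the normalized integrals below tend to zero.
  have hj (k : ℕ) : ∃ j, (2 * 3 ^ k : ℝ≥0∞) ^ m * 2 ^ k <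
      ∫⁻ t in K j, ∏ i, ENNReal.ofReal (Real.log (2 / t i)) ∂ν := by
    rw [← lt_iSup_iff, hsup]
    finiteness
  choose j hj using hj
  set A : ℕ → ℝ≥0∞ := fun k => ∫⁻ t in K (j k), ∏ i, ENNReal.ofReal (Real.log (2 / t i)) ∂ν with hA
  have hA0 (k : ℕ) : A k ≠ 0 := (zero_le.trans_lt (hj k)).ne'
  have hAt (k : ℕ) : A k ≠ ∞ := (hfin (j k)).ne
  have hbits (k : ℕ) : ∃ χ : Fin m → RSpace n → Bool, (∀ i, Measurable (χ i)) ∧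
      volume (annulus n) * ((2⁻¹ : ℝ≥0∞) ^ m * A k) ≤
        ∫⁻ x in annulus n, ∫⁻ t in K (j k), bitKernel χ x t ∂ν := by
    obtain ⟨δ, T, hδ, hb⟩ := hKb (j k)
    obtain ⟨M, κ, hκ, hsep⟩ := exists_separating_cells (n := n) hδ hb
    exact exists_bits_lintegral_bitKernel_ge (hKm _) (hKc _) hκ hsep
  choose χ hχ hge using hbits
  refine ⟨fun i x => digitSum fun k => χ k i x, fun i => measurable_digitSum fun k => hχ k i,
    fun i x => abs_digitSum_le _, fun hae => ?_⟩
  set u : Fin m → RSpace n → ℝ := fun i x => digitSum fun k => χ k i x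
  -- Three facts conflict: `H k ≤ 2 ^ m`, `H k → 0` wherever the oscillation integral is finite, and
  -- the integral of `H k` over the annulus stays above a positive constant.
  set H : ℕ → RSpace n → ℝ≥0∞ := fun k x => (∫⁻ t in K (j k), bitKernel (χ k) x t ∂ν) / A k
    with hH
  have hHmeas (k : ℕ) : Measurable (H k) :=
    (measurable_bitKernel (hχ k)).lintegral_prod_right'.div_const _
  have hHle (k : ℕ) (x : RSpace n) : H k x ≤ 2 ^ m := by
    refine ENNReal.div_le_of_le_mul ?_
    rw [hA, ← lintegral_const_mul' _ _ (by finiteness)]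
    refine setLIntegral_mono' (hKm _) fun t ht => ?_
    calc bitKernel (χ k) x t ≤ ∏ i, 2 * ENNReal.ofReal (Real.log (2 / t i)) := by
          unfold bitKernel
          gcongr with i _
          exact ofReal_log_inv_add_bitDiff_le (hKc _ ht i trivial) _
      _ = _ := by rw [Finset.prod_mul_distrib]; simp
  have hHZ (k : ℕ) (x : RSpace n) :
      H k x ≤ (∫⁻ t in unitCube m, oscillationKernel u x t ∂ν) * (2⁻¹ : ℝ≥0∞) ^ k := by
    have h1 : ∫⁻ t in K (j k), bitKernel (χ k) x t ∂ν ≤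
        (2 * 3 ^ k) ^ m * ∫⁻ t in unitCube m, oscillationKernel u x t ∂ν := by
      rw [← lintegral_const_mul' _ _ (by finiteness)]
      refine (setLIntegral_mono' (hKm _) fun t ht => ?_).trans (lintegral_mono_set (hKc _))
      calc bitKernel (χ k) x t ≤ ∏ i, 2 * 3 ^ k *
            ENNReal.ofReal (Real.log (t i)⁻¹ + |u i x - u i ((t i)⁻¹ • x)|) := by
            unfold bitKernel
            gcongr with i _
            exact ofReal_log_inv_add_bitDiff_le_digitSum (hKc _ ht i trivial)
              (fun l => χ l i x) (fun l => χ l i ((t i)⁻¹ • x)) k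
        _ = _ := by rw [Finset.prod_mul_distrib]; simp [oscillationKernel]
    refine ENNReal.div_le_of_le_mul (h1.trans ?_)
    calc _ = (∫⁻ t in unitCube m, oscillationKernel u x t ∂ν) * (2⁻¹ : ℝ≥0∞) ^ k *
          ((2 * 3 ^ k) ^ m * 2 ^ k) := by
          have : (2⁻¹ : ℝ≥0∞) ^ k * 2 ^ k = 1 := by
            rw [← mul_pow, ENNReal.inv_mul_cancel two_ne_zero ENNReal.ofNat_ne_top, one_pow]
          rw [mul_comm ((2 * 3 ^ k : ℝ≥0∞) ^ m) (2 ^ k), mul_assoc, ← mul_assoc (2⁻¹ ^ k), this,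
            one_mul, mul_comm]
      _ ≤ _ := by gcongr; exact (hj k).le
  have hlim : ∀ᵐ x ∂volume.restrict (annulus n),
      Filter.Tendsto (fun k => H k x) Filter.atTop (nhds 0) := by
    filter_upwards [ae_restrict_of_ae hae] with x hx
    refine tendsto_of_tendsto_of_tendsto_of_le_of_le tendsto_const_nhds ?_ (fun _ => zero_le)
      fun k => hHZ k x
    have := ENNReal.Tendsto.const_mul (a := ∫⁻ t in unitCube m, oscillationKernel u x t ∂ν)
      (ENNReal.tendsto_pow_atTop_nhds_zero_of_lt_one (r := 2⁻¹) (by simp)) (Or.inr hx.ne)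
    simpa using this
  have hdct := tendsto_lintegral_of_dominated_convergence (μ := volume.restrict (annulus n))
    (f := fun _ => 0) (fun _ => (2 : ℝ≥0∞) ^ m) hHmeas (fun k => ae_of_all _ (hHle k))
    (by rw [setLIntegral_const]; exact ENNReal.mul_ne_top (by finiteness) volume_annulus_ne_top)
    hlim
  rw [lintegral_zero] at hdct
  have hlow (k : ℕ) : volume (annulus n) * (2⁻¹ : ℝ≥0∞) ^ m ≤ ∫⁻ x in annulus n, H k x := by
    simp only [hH, div_eq_mul_inv]
    rw [lintegral_mul_const' _ _ (ENNReal.inv_ne_top.2 (hA0 k)), ← div_eq_mul_inv,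
      ENNReal.le_div_iff_mul_le (Or.inl (hA0 k)) (Or.inl (hAt k)), mul_assoc]
    exact hge k
  have := ge_of_tendsto' hdct hlow
  have h0 : volume (annulus n) * (2⁻¹ : ℝ≥0∞) ^ m = 0 := le_antisymm this zero_le
  rcases mul_eq_zero.1 h0 with h | h
  · exact volume_annulus_ne_zero hn h
  · exact pow_ne_zero m (ENNReal.inv_ne_zero.2 ENNReal.ofNat_ne_top) h

end Divergence

/-! ### Necessity of the integral condition -/

section Necessity

variable {m n : ℕ}

/-- The power weight of the multilinear Cesàro operator on radial powers. -/
noncomputable def powerWeight (n : ℕ) (L : Fin m → ℝ) (ω : (Fin m → ℝ) → ℝ) (t : Fin m → ℝ) : ℝ :=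
  (∏ i, t i ^ (-((n : ℝ) * L i) - (n : ℝ))) * ω t

lemma powerWeight_nonneg {L : Fin m → ℝ} {ω : (Fin m → ℝ) → ℝ} {t : Fin m → ℝ}
    (ht : t ∈ unitCube m) (hω : 0 ≤ ω t) : 0 ≤ powerWeight n L ω t :=
  mul_nonneg (Finset.prod_nonneg fun i _ => Real.rpow_nonneg (ht i trivial).1.le _) hω

/-- The real part of the difference is `-log (1/t)` and the imaginary part is the oscillation of
`u`; the modulus dominates each, hence their mean. Complex values prevent cancellation between the
two. -/
lemma half_le_norm_logSymbol_sub (u : RSpace n → ℝ) {x : RSpace n} (hx : x ≠ 0) {t : ℝ}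
    (ht : t ∈ Set.Ioo (0 : ℝ) 1) :
    (Real.log t⁻¹ + |u x - u (t⁻¹ • x)|) / 2 ≤ ‖logSymbol u x - logSymbol u (t⁻¹ • x)‖ := by
  have hlogt : 0 ≤ Real.log t⁻¹ := Real.log_nonneg ((one_le_inv₀ ht.1).2 ht.2.le)
  set z := logSymbol u x - logSymbol u (t⁻¹ • x) with hz
  have hre : z.re = -Real.log t⁻¹ := by
    simp only [hz, logSymbol, norm_smul, Real.norm_of_nonneg (inv_nonneg.2 ht.1.le),
      Real.log_mul (inv_ne_zero ht.1.ne') (norm_ne_zero_iff.2 hx)]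
    simp
  have him : z.im = u x - u (t⁻¹ • x) := by simp [hz, logSymbol]
  have h1 := Complex.abs_re_le_norm z
  have h2 := Complex.abs_im_le_norm z
  rw [hre, abs_neg, abs_of_nonneg hlogt] at h1
  rw [him] at h2
  linarith

lemma mul_oscillationKernel_le_enorm_cesaroIntegrand {L : Fin m → ℝ} {ω : (Fin m → ℝ) → ℝ}
    (u : Fin m → RSpace n → ℝ) {x : RSpace n} (hx : x ≠ 0) {t : Fin m → ℝ} (ht : t ∈ unitCube m)
    (hω : 0 ≤ ω t) :
    ENNReal.ofReal (∏ i, (‖x‖ ^ ((n : ℝ) * L i) / 2)) *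
        (ENNReal.ofReal (powerWeight n L ω t) * oscillationKernel u x t) ≤
      ‖cesaroIntegrand ω (fun i => logSymbol (u i)) (fun i => radialPower n (L i)) x t‖ₑ := by
  have ht0 (i : Fin m) : 0 < t i := (ht i trivial).1
  have hx0 : 0 < ‖x‖ := norm_pos_iff.2 hx
  have hlogt (i : Fin m) : 0 ≤ Real.log (t i)⁻¹ :=
    Real.log_nonneg ((one_le_inv₀ (ht0 i)).2 (ht i trivial).2.le)
  have hnn (i : Fin m) : 0 ≤ Real.log (t i)⁻¹ + |u i x - u i ((t i)⁻¹ • x)| :=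
    add_nonneg (hlogt i) (abs_nonneg _)
  have hf (i : Fin m) : ‖radialPower n (L i) ((t i)⁻¹ • x) * (((t i ^ n)⁻¹ : ℝ) : ℂ)‖ =
      ‖x‖ ^ ((n : ℝ) * L i) * t i ^ (-((n : ℝ) * L i) - (n : ℝ)) := by
    rw [norm_mul, radialPower, Complex.norm_real, Complex.norm_real,
      Real.norm_of_nonneg (Real.rpow_nonneg (norm_nonneg _) _),
      Real.norm_of_nonneg (inv_nonneg.2 (pow_nonneg (ht0 i).le n)), norm_smul,
      Real.norm_of_nonneg (inv_nonneg.2 (ht0 i).le), Real.mul_rpow (inv_nonneg.2 (ht0 i).le) hx0.le,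
      Real.inv_rpow (ht0 i).le, Real.rpow_sub (ht0 i), Real.rpow_neg (ht0 i).le, Real.rpow_natCast]
    ring
  rw [oscillationKernel, ← ENNReal.ofReal_prod_of_nonneg fun i _ => hnn i,
    ← ENNReal.ofReal_mul (powerWeight_nonneg ht hω),
    ← ENNReal.ofReal_mul (Finset.prod_nonneg fun i _ => by positivity), ← ofReal_norm]
  refine ENNReal.ofReal_le_ofReal ?_
  rw [cesaroIntegrand, norm_mul, norm_mul, norm_prod, norm_prod, Complex.norm_real,
    Real.norm_of_nonneg hω]
  simp only [hf]
  calc _ = (∏ i, ‖x‖ ^ ((n : ℝ) * L i) * t i ^ (-((n : ℝ) * L i) - (n : ℝ))) *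
        (∏ i, (Real.log (t i)⁻¹ + |u i x - u i ((t i)⁻¹ • x)|) / 2) * ω t := by
        rw [powerWeight]
        simp only [div_eq_mul_inv, Finset.prod_mul_distrib]
        ring
    _ ≤ _ := by
        refine mul_le_mul_of_nonneg_right (mul_le_mul_of_nonneg_left
          (Finset.prod_le_prod (fun i _ => div_nonneg (hnn i) zero_le_two)
            fun i _ => half_le_norm_logSymbol_sub (u i) hx (ht i trivial)) ?_) hω
        exact Finset.prod_nonneg fun i _ => mul_nonneg (by positivity)
          (Real.rpow_nonneg (ht0 i).le _)

/-- The compact subcube `[1/(j+2), 1 - 1/(j+2)]^m`. -/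
def compactCube (m j : ℕ) : Set (Fin m → ℝ) :=
  Set.univ.pi fun _ => Set.Icc (1 / ((j : ℝ) + 2)) (1 - 1 / ((j : ℝ) + 2))

lemma isCompact_compactCube (j : ℕ) : IsCompact (compactCube m j) :=
  isCompact_univ_pi fun _ => isCompact_Icc

lemma monotone_compactCube : Monotone (compactCube m) := by
  intro j k hjk t ht i hi
  have hjk' : (j : ℝ) ≤ k := by exact_mod_cast hjk
  have h : 1 / ((k : ℝ) + 2) ≤ 1 / ((j : ℝ) + 2) := by gcongr
  exact ⟨h.trans (ht i hi).1, (ht i hi).2.trans (by linarith)⟩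

lemma compactCube_subset_unitCube (j : ℕ) : compactCube m j ⊆ unitCube m := by
  intro t ht i hi
  have h : 0 < 1 / ((j : ℝ) + 2) := by positivity
  exact ⟨h.trans_le (ht i hi).1, (ht i hi).2.trans_lt (by linarith)⟩

lemma iUnion_compactCube : ⋃ j, compactCube m j = unitCube m := by
  refine Set.Subset.antisymm (Set.iUnion_subset compactCube_subset_unitCube) fun t ht => ?_
  have h (i : Fin m) : ∀ᶠ j : ℕ in Filter.atTop,
      t i ∈ Set.Icc (1 / ((j : ℝ) + 2)) (1 - 1 / ((j : ℝ) + 2)) := by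
    have hlim : Filter.Tendsto (fun j : ℕ => 1 / ((j : ℝ) + 2)) Filter.atTop (nhds 0) := by
      simp only [one_div]
      exact tendsto_inv_atTop_zero.comp
        (Filter.tendsto_atTop_add_const_right _ _ tendsto_natCast_atTop_atTop)
    filter_upwards [hlim.eventually_le_const (ht i trivial).1,
      hlim.eventually_le_const (sub_pos.2 (ht i trivial).2)] with j h1 h2
    exact ⟨h1, by linarith⟩
  obtain ⟨j, hj⟩ := (Filter.eventually_all.2 h).exists
  exact Set.mem_iUnion.2 ⟨j, fun i _ => hj i⟩

lemma exists_log_bounds_compactCube (j : ℕ) : ∃ δ T : ℝ, 0 < δ ∧ ∀ t ∈ compactCube m j, ∀ i,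
    0 < t i ∧ δ ≤ Real.log (t i)⁻¹ ∧ Real.log (t i)⁻¹ ≤ T := by
  have hj : 0 < 1 / ((j : ℝ) + 2) := by positivity
  have hj' : 0 < 1 - 1 / ((j : ℝ) + 2) := by
    rw [sub_pos, div_lt_one (by positivity)]
    linarith [(Nat.cast_nonneg j : (0 : ℝ) ≤ j)]
  refine ⟨-Real.log (1 - 1 / ((j : ℝ) + 2)), -Real.log (1 / ((j : ℝ) + 2)),
    neg_pos.2 (Real.log_neg hj' (by linarith)), fun t ht i => ?_⟩
  have h := ht i trivial
  have h0 : 0 < t i := hj.trans_le h.1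
  rw [Real.log_inv]
  exact ⟨h0, neg_le_neg (Real.log_le_log h0 h.2), neg_le_neg (Real.log_le_log hj h.1)⟩

lemma integrableOn_powerWeight_mul_prod_log {L : Fin m → ℝ} {ω : (Fin m → ℝ) → ℝ}
    (hω : IntegrableOn ω (unitCube m)) (j : ℕ) :
    IntegrableOn (fun t => powerWeight n L ω t * ∏ i, Real.log (2 / t i)) (compactCube m j) := by
  have hne (t : Fin m → ℝ) (ht : t ∈ compactCube m j) (i : Fin m) : t i ≠ 0 :=
    (compactCube_subset_unitCube j ht i trivial).1.ne'
  have hcont : ContinuousOn (fun t : Fin m → ℝ =>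
      (∏ i, t i ^ (-((n : ℝ) * L i) - (n : ℝ))) * ∏ i, Real.log (2 / t i)) (compactCube m j) := by
    refine ContinuousOn.mul (continuousOn_finsetProd _ fun i _ => ?_)
      (continuousOn_finsetProd _ fun i _ => ?_)
    · exact (continuous_apply i).continuousOn.rpow_const fun t ht => Or.inl (hne t ht i)
    · exact (continuousOn_const.div (continuous_apply i).continuousOn fun t ht => hne t ht i).log
        fun t ht => div_ne_zero two_ne_zero (hne t ht i)
  refine ((hω.mono_set (compactCube_subset_unitCube j)).continuousOn_mul hcont
    (isCompact_compactCube j)).congr_fun (fun t _ => ?_) (isCompact_compactCube j).measurableSet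
  simp only [powerWeight]
  ring

theorem cesaroConst_lt_top_of_bounded (hn : 1 ≤ n) {p lam : ℝ} {P q L : Fin m → ℝ}
    (hP : ∀ i, 0 < P i) (hq : ∀ i, 1 < q i) (hL : ∀ i, -(1 / P i) < L i)
    {ω : (Fin m → ℝ) → ℝ} (hω0 : ∀ t ∈ unitCube m, 0 ≤ ω t) (hω : IntegrableOn ω (unitCube m))
    (hbdd : ∀ b : Fin m → RSpace n → ℂ, (∀ i, MemCMO (q i) (b i)) →
      CesaroCommutatorBounded p lam P L ω b) : cesaroConst n L ω < ∞ := by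
  by_contra hcon
  -- The logarithms stay outside the weight, since the test symbols have to recover them.
  set W : (Fin m → ℝ) → ℝ≥0∞ := fun t => ENNReal.ofReal (powerWeight n L ω t)
  have hWm : AEMeasurable W (volume.restrict (unitCube m)) := by
    refine (AEMeasurable.mul (Measurable.aemeasurable ?_)
      hω.aestronglyMeasurable.aemeasurable).ennreal_ofReal
    fun_prop
  set ν := (volume.restrict (unitCube m)).withDensity W with hν
  have hint {S : Set (Fin m → ℝ)} (hS : MeasurableSet S) (hSc : S ⊆ unitCube m)
      (g : (Fin m → ℝ) → ℝ≥0∞) : ∫⁻ t in S, g t ∂ν = ∫⁻ t in S, W t * g t := by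
    rw [hν, restrict_withDensity hS, Measure.restrict_restrict_of_subset hSc,
      lintegral_withDensity_eq_lintegral_mul_non_measurable₀ _
        (hWm.mono_measure (Measure.restrict_mono hSc le_rfl))
        (ae_of_all _ fun t => ENNReal.ofReal_lt_top)]
    rfl
  have hlog {t : Fin m → ℝ} (ht : t ∈ unitCube m) :
      W t * ∏ i, ENNReal.ofReal (Real.log (2 / t i)) =
        ENNReal.ofReal (powerWeight n L ω t * ∏ i, Real.log (2 / t i)) := by
    rw [ENNReal.ofReal_mul (powerWeight_nonneg ht (hω0 t ht)),
      ENNReal.ofReal_prod_of_nonneg fun i _ => (log_two_div_pos (ht i trivial)).le]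
  obtain ⟨u, hum, hub, hnot⟩ := exists_bounded_oscillation_diverges (n := n) hn (ν := ν)
    (fun j => (isCompact_compactCube j).measurableSet) monotone_compactCube iUnion_compactCube
    exists_log_bounds_compactCube
    (fun j => by
      have hs := (isCompact_compactCube (m := m) j).measurableSet
      rw [hint hs (compactCube_subset_unitCube j),
        setLIntegral_congr_fun hs fun t ht => hlog (compactCube_subset_unitCube j ht)]
      exact (integrableOn_powerWeight_mul_prod_log hω j).lintegral_lt_top)
    (by
      rw [hint measurableSet_unitCube subset_rfl,
        setLIntegral_congr_fun measurableSet_unitCube fun t ht => hlog ht]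
      exact not_lt_top_iff.1 hcon)
  obtain ⟨C, hC⟩ := hbdd (fun i => logSymbol (u i)) fun i =>
    memCMO_logSymbol hn (hq i) (hum i) (hub i)
  have hae := (hC (fun i => radialPower n (L i)) fun i =>
    memMorrey_radialPower hn (hP i) (hL i)).1
  refine hnot ?_
  have : Nonempty (Fin n) := ⟨⟨0, hn⟩⟩
  have hne : ∀ᵐ x : RSpace n, x ≠ 0 := by
    rw [ae_iff]; simp
  filter_upwards [hae, hne] with x hx hx0
  rw [hint measurableSet_unitCube subset_rfl]
  set c := ENNReal.ofReal (∏ i, (‖x‖ ^ ((n : ℝ) * L i) / 2))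
  have hc0 : c ≠ 0 := by
    have := norm_pos_iff.2 hx0
    rw [← pos_iff_ne_zero, ENNReal.ofReal_pos]
    exact Finset.prod_pos fun i _ => by positivity
  -- Absolute convergence at this `x` bounds the oscillation integral, as `c` is positive and
  -- independent of `t`.
  have h1 : c * ∫⁻ t in unitCube m, W t * oscillationKernel u x t < ∞ := by
    rw [← lintegral_const_mul' _ _ ENNReal.ofReal_ne_top]
    exact (setLIntegral_mono' measurableSet_unitCube fun t ht =>
      mul_oscillationKernel_le_enorm_cesaroIntegrand u hx0 ht (hω0 t ht)).trans_lt hx.2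
  exact lt_top_iff_ne_top.2 fun h => h1.ne (by rw [h, ENNReal.mul_top hc0])

end Necessity

theorem theorem4p2 (m n : ℕ) (hm : 2 ≤ m) (hn : 1 ≤ n)
    (p lam : ℝ) (P q L : Fin m → ℝ)
    (hp : 1 < p) (hP : ∀ i, p < P i) (hq : ∀ i, 1 < q i)
    (hL : ∀ i, -(1 / P i) < L i ∧ L i < 0)
    (hpq : 1 / p = ∑ i, 1 / P i + ∑ i, 1 / q i)
    (hlam : lam = ∑ i, L i)
    (ω : (Fin m → ℝ) → ℝ)
    (hω_nonneg : ∀ t ∈ Set.Icc (0 : Fin m → ℝ) 1, 0 ≤ ω t)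
    (hω_int : IntegrableOn ω (Set.Icc (0 : Fin m → ℝ) 1)) :
    (cesaroConst n L ω < ∞ →
      ∀ b : Fin m → RSpace n → ℂ, (∀ i, MemCMO (q i) (b i)) →
        CesaroCommutatorBounded p lam P L ω b) ∧
    ((∀ i j, L i * P i = L j * P j) →
      (∀ b : Fin m → RSpace n → ℂ, (∀ i, MemCMO (q i) (b i)) →
        CesaroCommutatorBounded p lam P L ω b) →
      cesaroConst n L ω < ∞) := by
  have hω0 : ∀ t ∈ unitCube m, 0 ≤ ω t := fun t ht => hω_nonneg t (unitCube_subset_Icc ht)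
  have hωi : IntegrableOn ω (unitCube m) := hω_int.mono_set unitCube_subset_Icc
  refine ⟨fun hfin b hb => ?_, fun _ hbdd => ?_⟩
  · rw [hlam]
    exact cesaroCommutatorBounded_of_cesaroConst_lt_top hp hP hq hpq hωi.aestronglyMeasurable hω0
      hfin hb
  · exact cesaroConst_lt_top_of_bounded hn (fun i => by linarith [hP i]) hq (fun i => (hL i).1) hω0
      hωi hbdd
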